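/- Let $0<\alpha<\sqrt3$ and $\beta=\tfrac12\alpha(1-\tfrac13\alpha^2)$. Let $L^2_\alpha=\{f:\mathbb R\to\mathbb C \mid e^{\alpha x}f\in L^2(\mathbb R)\}$, with norm $\|f\|_\alpha=\|e^{\alpha x}f\|_{L^2}$, and let $\Theta(x)=\operatorname{sech}^2(\sqrt3\,x/2)$. For $\lambda\in\mathbb C$ with $\operatorname{Re}\lambda>-\beta$, define the bounded operator $$W_0(\lambda)=I+\bigl(\lambda-\tfrac12\partial_x+\tfrac16\partial_x^3\bigr)^{-1}\partial_x\bigl(\tfrac32\Theta\,\cdot\,\bigr)\quad\text{on } L^2_\alpha ,$$ where $(\lambda-\frac12\partial_x+\frac16\partial_x^3)^{-1}\partial_x$ is the Fourier multiplier with symbol $m_\lambda(k)=ik/(\lambda-\frac12 ik+\frac16(ik)^3)$ acting on $L^2_\alpha$, i.e. conjugation by $f\mapsto e^{\alpha x}f$ turns it into the Fourier multiplier with symbol $m_\lambda(k+i\alpha)$ on $L^2(\mathbb R)$. For a family $W$ of bounded operators on a Hilbert space $X$, analytic on a domain of $\mathbb C$ with values that are Fredholm of index zero, a point $\lambda_0$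 is a characteristic value if $\ker W(\lambda_0)\neq\{0\}$. A root vector at $\lambda_0$ is an $X$-valued function $z$, analytic near $\lambda_0$, with $z(\lambda_0)\ne0$ and $W(\lambda_0)z(\lambda_0)=0$; its order is the order of $\lambda_0$ as a zero of $W(\lambda)z(\lambda)$. The rank of a nonzero $v\in\ker W(\lambda_0)$ is the supremum of the orders of the root vectors $z$ at $\lambda_0$ with $z(\lambda_0)=v$. A canonical system is a basis $v_1,\dots,v_r$ of $\ker W(\lambda_0)$ such that each $v_j$ has the greatest rank among the nonzero vectors of some direct complement of $\operatorname{span}(v_1,\dots,v_{j-1})$ in $\ker W(\lambda_0)$ that contains $v_j$. The null multiplicity of $\lambda_0$ is the sum of the ranks of the vectors of a canonical system (it does not depend on the system). Then $W_0$ is an analytic family of Fredholm operators of index zero on $\{\operatorname{Re}\lambda>-\beta\}$; the only characteristic value of $W_0$ in this half-plane is $\lambda=0$; and this characteristic value has null multiplicity $2$. -/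

import Mathlib

open MeasureTheory
open scoped ENNReal FourierTransform

noncomputable section

/-! ### The weighted space `L²_a` -/

/-- The measure `e^{2ax} dx` on the real line. -/
def expWeight (a : ℝ) : Measure ℝ :=
  volume.withDensity fun x => ENNReal.ofReal (Real.exp (2 * a * x))

/-- The Hilbert space `L²_a = {f | e^{ax} f ∈ L²(ℝ)}` of complex-valued functions, with
`‖f‖² = ∫ |f x|² e^{2ax} dx`. -/
abbrev WeightedL2 (a : ℝ) : Type := Lp ℂ 2 (expWeight a)

theorem ae_expWeight (a : ℝ) : ae (expWeight a) = ae (volume : Measure ℝ) := by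
  ext s
  have h := ae_withDensity_iff (μ := (volume : Measure ℝ)) (p := fun x => x ∈ s)
    (f := fun x => ENNReal.ofReal (Real.exp (2 * a * x))) (by fun_prop)
  have h' : ∀ x : ℝ, ENNReal.ofReal (Real.exp (2 * a * x)) ≠ 0 := fun x => by
    simp [Real.exp_pos]
  simpa [expWeight, h', Filter.Eventually] using h

theorem aestronglyMeasurable_expWeight_iff (a : ℝ) (f : ℝ → ℂ) :
    AEStronglyMeasurable f (expWeight a) ↔ AEStronglyMeasurable f volume :=
  ⟨fun h => h.mono_ac (Measure.ae_le_iff_absolutelyContinuous.1 (ae_expWeight a).ge),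
   fun h => h.mono_ac (Measure.ae_le_iff_absolutelyContinuous.1 (ae_expWeight a).le)⟩

theorem eLpNorm_expWeight (a : ℝ) (f : ℝ → ℂ) :
    eLpNorm (fun x => (Real.exp (a * x) : ℂ) * f x) 2 volume = eLpNorm f 2 (expWeight a) := by
  rw [eLpNorm_eq_lintegral_rpow_enorm_toReal (by norm_num) (by norm_num),
    eLpNorm_eq_lintegral_rpow_enorm_toReal (by norm_num) (by norm_num), expWeight,
    lintegral_withDensity_eq_lintegral_mul_non_measurable _ (by fun_prop) (by simp)]
  congr 2
  funext x
  have h1 : ‖(Real.exp (a * x) : ℂ)‖ₑ = ENNReal.ofReal (Real.exp (a * x)) := by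
    rw [← ofReal_norm, Complex.norm_real, Real.norm_of_nonneg (Real.exp_pos _).le]
  have h2 : 2 * a * x = a * x + a * x := by ring
  simp only [enorm_mul, h1, Pi.mul_apply, ENNReal.toReal_ofNat, ENNReal.rpow_ofNat, mul_pow, h2,
    Real.exp_add, ENNReal.ofReal_mul (Real.exp_pos _).le, sq (ENNReal.ofReal _)]

theorem memLp_expWeight_iff (a : ℝ) (f : ℝ → ℂ) :
    MemLp (fun x => (Real.exp (a * x) : ℂ) * f x) 2 volume ↔ MemLp f 2 (expWeight a) := by
  have hc : ∀ b : ℝ, AEStronglyMeasurable (fun x : ℝ => (Real.exp (b * x) : ℂ)) volume :=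
    fun b => (by fun_prop : Continuous fun x : ℝ => (Real.exp (b * x) : ℂ)).aestronglyMeasurable
  unfold MemLp
  rw [eLpNorm_expWeight, aestronglyMeasurable_expWeight_iff]
  refine and_congr_left fun _ => ⟨fun h => ?_, fun h => (hc a).mul h⟩
  refine ((hc (-a)).mul h).congr (Filter.Eventually.of_forall fun x => ?_)
  simp only [Pi.mul_apply, ← mul_assoc, ← Complex.ofReal_mul, ← Real.exp_add]
  simp

/-- The map `f ↦ e^{ax} f` from `L²_a` to `L²(ℝ)`. -/
def weightMap (a : ℝ) (f : WeightedL2 a) : Lp ℂ 2 (volume : Measure ℝ) :=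
  ((memLp_expWeight_iff a f).2 (Lp.memLp f)).toLp (fun x => (Real.exp (a * x) : ℂ) * f x)

theorem norm_weightMap (a : ℝ) (f : WeightedL2 a) : ‖weightMap a f‖ = ‖f‖ := by
  rw [weightMap, Lp.norm_toLp, eLpNorm_expWeight, Lp.norm_def]

theorem weightMap_add (a : ℝ) (f g : WeightedL2 a) :
    weightMap a (f + g) = weightMap a f + weightMap a g := by
  unfold weightMap
  rw [← MemLp.toLp_add]
  refine MemLp.toLp_congr _ _ ?_
  have h := Lp.coeFn_add f g
  rw [Filter.EventuallyEq, ae_expWeight] at h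
  filter_upwards [h] with x hx
  rw [hx, Pi.add_apply, Pi.add_apply, mul_add]

theorem weightMap_smul (a : ℝ) (c : ℂ) (f : WeightedL2 a) :
    weightMap a (c • f) = c • weightMap a f := by
  unfold weightMap
  rw [← MemLp.toLp_const_smul]
  refine MemLp.toLp_congr _ _ ?_
  have h := Lp.coeFn_smul c f
  rw [Filter.EventuallyEq, ae_expWeight] at h
  filter_upwards [h] with x hx
  rw [hx, Pi.smul_apply, Pi.smul_apply, smul_eq_mul, smul_eq_mul]
  ring

theorem weightMap_surjective (a : ℝ) : Function.Surjective (weightMap a) := fun g => by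
  have hg : (fun x => (Real.exp (a * x) : ℂ) * ((Real.exp (-(a * x)) : ℂ) * g x)) = g := by
    funext x
    rw [← mul_assoc, ← Complex.ofReal_mul, ← Real.exp_add]
    simp
  have hm : MemLp (fun x => (Real.exp (-(a * x)) : ℂ) * g x) 2 (expWeight a) := by
    rw [← memLp_expWeight_iff, hg]
    exact Lp.memLp g
  refine ⟨hm.toLp _, ?_⟩
  have h := hm.coeFn_toLp
  rw [Filter.EventuallyEq, ae_expWeight] at h
  refine Lp.ext ((MemLp.coeFn_toLp _).trans ?_)
  filter_upwards [h] with x hx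
  rw [hx]
  exact congrFun hg x

/-- The isometric isomorphism `f ↦ e^{ax} f` from `L²_a` onto `L²(ℝ)`. -/
def weightIso (a : ℝ) : WeightedL2 a ≃ₗᵢ[ℂ] Lp ℂ 2 (volume : Measure ℝ) :=
  LinearIsometryEquiv.ofSurjective
    { toFun := weightMap a
      map_add' := weightMap_add a
      map_smul' := weightMap_smul a
      norm_map' := norm_weightMap a }
    (weightMap_surjective a)

/-! ### Multiplication operators and Fourier multipliers -/

open Classical in
/-- The bounded operator `f ↦ m f` on `L²(μ)`, for an essentially bounded measurable `m`
(and `0` by convention for all other `m`). -/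
def mulL2 (μ : Measure ℝ) (m : ℝ → ℂ) : Lp ℂ 2 μ →L[ℂ] Lp ℂ 2 μ :=
  if h : MemLp m ∞ μ then (ContinuousLinearMap.mul ℂ ℂ).holderL μ ∞ 2 2 (h.toLp m) else 0

/-- The Fourier multiplier `m(D)`, `D = -i d/dx`, acting on `L²_a`: conjugation by `f ↦ e^{ax} f`
turns it into the Fourier multiplier `m(D + ia)` on `L²(ℝ)`. Mathlib's Fourier transform is
`𝓕 f ξ = ∫ e^{-2πixξ} f x dx`, hence the wave number is `k = 2πξ`. -/
def fourierMultiplier (a : ℝ) (m : ℂ → ℂ) : WeightedL2 a →L[ℂ] WeightedL2 a :=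
  ((weightIso a).symm : Lp ℂ 2 (volume : Measure ℝ) →L[ℂ] WeightedL2 a) ∘L
    ((Lp.fourierTransformₗᵢ ℝ ℂ).symm :
      Lp ℂ 2 (volume : Measure ℝ) →L[ℂ] Lp ℂ 2 (volume : Measure ℝ)) ∘L
    mulL2 volume (fun ξ : ℝ => m (((2 * Real.pi * ξ : ℝ) : ℂ) + Complex.I * (a : ℂ))) ∘L
    ((Lp.fourierTransformₗᵢ ℝ ℂ) :
      Lp ℂ 2 (volume : Measure ℝ) →L[ℂ] Lp ℂ 2 (volume : Measure ℝ)) ∘L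
    ((weightIso a) : WeightedL2 a →L[ℂ] Lp ℂ 2 (volume : Measure ℝ))

/-! ### The KdV bundle -/

/-- The soliton profile `Θ(x) = sech²(√3 x / 2)`. -/
def soliton (x : ℝ) : ℝ := (1 / Real.cosh (√3 * x / 2)) ^ 2

/-- The symbol, as a function of the wave number `k` (so that `d/dx` has symbol `ik`),
of `(z - ½ ∂ + ⅙ ∂³)⁻¹ ∂`. -/
def kdvSymbol (z k : ℂ) : ℂ :=
  (Complex.I * k) / (z - 1 / 2 * (Complex.I * k) + 1 / 6 * (Complex.I * k) ^ 3)

/-- The bundle `W₀(z) = I + (z - ½ ∂ + ⅙ ∂³)⁻¹ ∂ (3/2 Θ ·)` on `L²_a`. -/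
def kdvBundle (a : ℝ) (z : ℂ) : WeightedL2 a →L[ℂ] WeightedL2 a :=
  ContinuousLinearMap.id ℂ (WeightedL2 a) +
    fourierMultiplier a (kdvSymbol z) ∘L
      mulL2 (expWeight a) (fun x => ((3 / 2 * soliton x : ℝ) : ℂ))

/-! ### Characteristic values and null multiplicity of operator bundles -/

section Bundle

variable {X : Type*} [NormedAddCommGroup X] [NormedSpace ℂ X]

/-- `W` is an analytic operator bundle on `Ω` whose values are Fredholm operators of index zero. -/
structure IsFredholmBundle (W : ℂ → X →L[ℂ] X) (Ω : Set ℂ) : Prop where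
  analyticOnNhd : AnalyticOnNhd ℂ W Ω
  isFredholm : ∀ z ∈ Ω, (W z).IsFredholm
  index_eq_zero : ∀ z ∈ Ω, Module.finrank ℂ (W z).ker = Module.finrank ℂ (X ⧸ (W z).range)

/-- `z₀` is a characteristic value of the bundle `W`: the kernel of `W z₀` is nontrivial. -/
def IsCharacteristicValue (W : ℂ → X →L[ℂ] X) (z₀ : ℂ) : Prop :=
  ∃ v : X, v ≠ 0 ∧ W z₀ v = 0

/-- A root vector (root function) of `W` at `z₀`: an `X`-valued function `f`, analytic at `z₀`,
with `f z₀ ≠ 0` and `W z₀ (f z₀) = 0`. -/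
structure IsRootVector (W : ℂ → X →L[ℂ] X) (z₀ : ℂ) (f : ℂ → X) : Prop where
  analyticAt : AnalyticAt ℂ f z₀
  ne_zero : f z₀ ≠ 0
  apply_eq_zero : W z₀ (f z₀) = 0

/-- The order of a root vector `f` at `z₀`: the order of `z₀` as a zero of `z ↦ W z (f z)`. -/
def rootOrder (W : ℂ → X →L[ℂ] X) (z₀ : ℂ) (f : ℂ → X) : ℕ∞ :=
  analyticOrderAt (fun z => W z (f z)) z₀

/-- The rank of a vector `v ≠ 0` in the kernel of `W z₀`: the supremum of the orders of all root
vectors `f` at `z₀` with `f z₀ = v`. -/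
def eigenRank (W : ℂ → X →L[ℂ] X) (z₀ : ℂ) (v : X) : ℕ∞ :=
  ⨆ (f : ℂ → X) (_ : IsRootVector W z₀ f) (_ : f z₀ = v), rootOrder W z₀ f

/-- A canonical system of eigenvectors of `W` at `z₀`: a basis `v₁, …, v_r` of the kernel of `W z₀`
such that, for each `j`, the vector `v_j` has the greatest rank among all nonzero vectors of some
direct complement, in the kernel of `W z₀`, of the span of `v₁, …, v_{j-1}`. -/
structure IsCanonicalSystem (W : ℂ → X →L[ℂ] X) (z₀ : ℂ) {r : ℕ} (v : Fin r → X) : Prop where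
  linearIndependent : LinearIndependent ℂ v
  span_eq : Submodule.span ℂ (Set.range v) = (W z₀).ker
  maximal : ∀ j : Fin r, ∃ C : Submodule ℂ X,
    Disjoint (Submodule.span ℂ (v '' {i | i < j})) C ∧
    Submodule.span ℂ (v '' {i | i < j}) ⊔ C = (W z₀).ker ∧
    v j ∈ C ∧ ∀ u ∈ C, u ≠ 0 → eigenRank W z₀ u ≤ eigenRank W z₀ (v j)

/-- `W` is analytic at `z₀` and its null multiplicity at `z₀` is `n`: canonical systems of
eigenvectors at `z₀` exist, and the sum of the ranks is `n` for each of them. -/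
structure HasNullMultiplicity (W : ℂ → X →L[ℂ] X) (z₀ : ℂ) (n : ℕ) : Prop where
  analyticAt : AnalyticAt ℂ W z₀
  exists_canonicalSystem : ∃ (r : ℕ) (v : Fin r → X), IsCanonicalSystem W z₀ v
  sum_eq : ∀ (r : ℕ) (v : Fin r → X), IsCanonicalSystem W z₀ v →
    ∑ j, eigenRank W z₀ (v j) = (n : ℕ∞)

end Bundle

end

noncomputable section

open SchwartzMap
open scoped ContDiff Topology

/-! Conjugate by e^{ax} and move every operator onto Schwartz test functions. With D = d/dx + a, put
A = `freeOp a` and L = `solitonOp a`; these are minus the transposes of the conjugated operators -½∂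
+ ⅙∂³ and -½∂ + ⅙∂³ + ∂(3/2 Θ ·). Then W₀(z)f = g means ⟨(z - A)φ, g⟩ = ⟨(z - L)φ, f⟩ for all φ,
where f and g on the right carry the weight (`kdvBundle_eq_iff`).

The linearisation at the soliton is linked to the free operator by a Darboux transformation: L B = B
A with B = `darbouxOp a` of second order (`solitonOp_darbouxOp`). For Re z > -β the symbol of z - A
has real part at least Re z + β > 0, so z - A is onto the Schwartz space (`exists_sub_freeOp_eq`).
Testing W₀(z)f = 0 with φ = Bψ therefore shows that f annihilates the range of B. That annihilator
is the plane spanned by the weighted derivatives of the soliton in position and in speed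
(`exists_eq_add_of_darbouxOp`), and on it the transpose of L is a nilpotent Jordan block of size
two.

Hence zf = Lᵀf forces z²f = 0, so 0 is the only characteristic value and its kernel is a line. A
Jordan chain of length three would also lie in the plane, which is impossible (`eq_zero_of_chain`);
a chain of length two is explicit. So every kernel vector has rank two.

The Fredholm property comes from compactness of W₀(z) - I, whose Fourier form is multiplication by
Θ, a Fourier transform, and multiplication by a square integrable symbol. At z = 0 the index is read
off from a rank one perturbation (`isFredholm_of_ker_eq_span`). -/

/-! ### Criteria for temperate growth and rapid decay. -/

theorem iteratedDeriv_mem_of_closed {A : Set (ℝ → ℂ)}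
    (hA : ∀ f ∈ A, ∃ f' ∈ A, ∀ x, HasDerivAt f (f' x) x) {f : ℝ → ℂ} (hf : f ∈ A) (n : ℕ) :
    iteratedDeriv n f ∈ A := by
  induction n with
  | zero => simpa using hf
  | succ n ih =>
    obtain ⟨f', hf', h⟩ := hA _ ih
    rw [iteratedDeriv_succ, show deriv (iteratedDeriv n f) = f' from funext fun x => (h x).deriv]
    exact hf'

theorem contDiff_of_closed {A : Set (ℝ → ℂ)}
    (hA : ∀ f ∈ A, ∃ f' ∈ A, ∀ x, HasDerivAt f (f' x) x) {f : ℝ → ℂ} (hf : f ∈ A) :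
    ContDiff ℝ ∞ f := by
  refine contDiff_of_differentiable_iteratedDeriv fun m _ => ?_
  obtain ⟨f', -, h⟩ := hA _ (iteratedDeriv_mem_of_closed hA hf m)
  exact fun x => (h x).differentiableAt

/-- If a set of functions is stable under differentiation and consists of functions of polynomial
growth, then its elements have temperate growth. -/
theorem hasTemperateGrowth_of_closed {A : Set (ℝ → ℂ)}
    (hA : ∀ f ∈ A, ∃ f' ∈ A, ∀ x, HasDerivAt f (f' x) x)
    (hgrowth : ∀ f ∈ A, ∃ (k : ℕ) (C : ℝ), ∀ x, ‖f x‖ ≤ C * (1 + ‖x‖) ^ k) {f : ℝ → ℂ}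
    (hf : f ∈ A) : f.HasTemperateGrowth := by
  refine ⟨contDiff_of_closed hA hf, fun n => ?_⟩
  obtain ⟨k, C, h⟩ := hgrowth _ (iteratedDeriv_mem_of_closed hA hf n)
  exact ⟨k, C, fun x => by rw [norm_iteratedFDeriv_eq_norm_iteratedDeriv]; exact h x⟩

/-- The space of rapidly decreasing solutions of `G' = h G` with `h` of temperate growth. -/
theorem exists_schwartzMap_of_hasDerivAt {G h : ℝ → ℂ} (hh : h.HasTemperateGrowth)
    (hG : ∀ x, HasDerivAt G (h x * G x) x)
    (hdecay : ∀ k : ℕ, ∃ C : ℝ, ∀ x, (1 + ‖x‖) ^ k * ‖G x‖ ≤ C) : ∃ g : 𝓢(ℝ, ℂ), ⇑g = G := by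
  -- Multiples of `G` by functions of temperate growth are stable under differentiation: (qG)' = (q'
  -- + qh)G.
  let A : Set (ℝ → ℂ) := {f | ∃ q : ℝ → ℂ, q.HasTemperateGrowth ∧ f = fun x => q x * G x}
  have hA : ∀ f ∈ A, ∃ f' ∈ A, ∀ x, HasDerivAt f (f' x) x := by
    rintro f ⟨q, hq, rfl⟩
    have hq' : (deriv q).HasTemperateGrowth := by
      refine ⟨((contDiff_succ_iff_deriv (n := ∞)).1 hq.1).2.2, fun n => ?_⟩
      obtain ⟨k, C, hC⟩ := hq.2 (n + 1)
      refine ⟨k, C, fun x => ?_⟩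
      have := hC x
      rwa [norm_iteratedFDeriv_eq_norm_iteratedDeriv, iteratedDeriv_succ',
        ← norm_iteratedFDeriv_eq_norm_iteratedDeriv] at this
    refine ⟨_, ⟨fun x => deriv q x + q x * h x, by fun_prop, rfl⟩, fun x => ?_⟩
    convert! ((hq.1.differentiable (by simp) x).hasDerivAt.mul (hG x)) using 1
    ring
  have hGA : G ∈ A := ⟨fun _ => 1, by fun_prop, by simp⟩
  refine ⟨⟨G, contDiff_of_closed hA hGA, fun k n => ?_⟩, rfl⟩
  obtain ⟨q, hq, hqG⟩ := iteratedDeriv_mem_of_closed hA hGA n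
  obtain ⟨l, C, hC⟩ := hq.2 0
  obtain ⟨M, hM⟩ := hdecay (k + l)
  refine ⟨|C| * M, fun x => ?_⟩
  have h1 : ‖q x‖ ≤ |C| * (1 + ‖x‖) ^ l := by
    have := hC x
    rw [norm_iteratedFDeriv_zero] at this
    exact this.trans (by gcongr; exact le_abs_self C)
  rw [norm_iteratedFDeriv_eq_norm_iteratedDeriv, hqG, norm_mul]
  calc ‖x‖ ^ k * (‖q x‖ * ‖G x‖) ≤ (1 + ‖x‖) ^ k * (|C| * (1 + ‖x‖) ^ l * ‖G x‖) := by
        gcongr; simp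
    _ = |C| * ((1 + ‖x‖) ^ (k + l) * ‖G x‖) := by ring
    _ ≤ |C| * M := by gcongr; exact hM x

theorem hasTemperateGrowth_polynomial (p : Polynomial ℂ) :
    (fun x : ℝ => p.eval (x : ℂ)).HasTemperateGrowth := by
  induction p using Polynomial.induction_on' with
  | add p q hp hq => simp only [Polynomial.eval_add]; fun_prop
  | monomial n a =>
    simp only [Polynomial.eval_monomial]
    have : (fun x : ℝ => (x : ℂ)).HasTemperateGrowth :=
      Function.Complex.hasTemperateGrowth_ofReal
    fun_prop

/-- The reciprocal of a polynomial that is bounded away from zero on the real line has temperate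
growth. -/
theorem hasTemperateGrowth_inv_polynomial (p : Polynomial ℂ) {δ : ℝ} (hδ : 0 < δ)
    (hp : ∀ x : ℝ, δ ≤ ‖p.eval (x : ℂ)‖) :
    (fun x : ℝ => (p.eval (x : ℂ))⁻¹).HasTemperateGrowth := by
  -- The fractions q/pⁿ are stable under differentiation and grow at most like q, since p is bounded
  -- below.
  let A : Set (ℝ → ℂ) := {f | ∃ (q : Polynomial ℂ) (n : ℕ),
    f = fun x : ℝ => q.eval (x : ℂ) * ((p.eval (x : ℂ))⁻¹) ^ n}
  refine hasTemperateGrowth_of_closed (A := A) ?_ ?_ ⟨1, 1, by simp⟩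
  · rintro f ⟨q, n, rfl⟩
    refine ⟨_, ⟨q.derivative * p - (n : Polynomial ℂ) * (q * p.derivative), n + 1, rfl⟩,
      fun x => ?_⟩
    have h0 : p.eval (x : ℂ) ≠ 0 := norm_pos_iff.1 (hδ.trans_le (hp x))
    have h1 := (q.hasDerivAt (x : ℂ)).comp_ofReal
    have h2 := (p.hasDerivAt (x : ℂ)).comp_ofReal
    convert! h1.mul ((h2.inv h0).pow n) using 1
    rcases n with _ | n
    · simp; field_simp
    · simp only [Polynomial.eval_sub, Polynomial.eval_mul, Polynomial.eval_natCast, Nat.add_sub_cancel]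
      simp only [Pi.inv_apply, Pi.pow_apply]
      generalize Polynomial.eval (x : ℂ) p = u at h0 ⊢
      generalize Polynomial.eval (x : ℂ) p.derivative = u'
      obtain ⟨i, rfl⟩ : ∃ i, u = i⁻¹ := ⟨u⁻¹, by simp⟩
      have hi : i ≠ 0 := by simpa using h0
      simp only [inv_inv, div_eq_mul_inv, inv_pow]
      field_simp
      ring
  · rintro f ⟨q, n, rfl⟩
    obtain ⟨k, C, hC⟩ := (hasTemperateGrowth_polynomial q).2 0
    refine ⟨k, C * (δ⁻¹) ^ n, fun x => ?_⟩
    have h1 := hC x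
    rw [norm_iteratedFDeriv_zero] at h1
    have hC0 : 0 ≤ C * (1 + ‖x‖) ^ k := (norm_nonneg _).trans h1
    rw [norm_mul, norm_pow, norm_inv]
    calc _ ≤ (C * (1 + ‖x‖) ^ k) * (δ⁻¹) ^ n := by
          gcongr
          exact hp x
      _ = _ := by ring

/-! ### The kink tanh and the weighted soliton profile. -/

/-- The function `tanh (√3 x / 2)`. -/
def kink (x : ℝ) : ℂ := ((Real.tanh (√3 / 2 * x) : ℝ) : ℂ)

theorem hasDerivAt_kink (x : ℝ) :
    HasDerivAt kink (((√3 : ℝ) : ℂ) / 2 * (1 - kink x ^ 2)) x := by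
  have h : HasDerivAt (fun x : ℝ => Real.tanh (√3 / 2 * x))
      (√3 / 2 * (1 - Real.tanh (√3 / 2 * x) ^ 2)) x := by
    have hc := Real.cosh_pos (√3 / 2 * x)
    have h0 : HasDerivAt (fun x : ℝ => √3 / 2 * x) (√3 / 2) x := by
      simpa using (hasDerivAt_id x).const_mul (√3 / 2)
    have h1 := (h0.sinh).div h0.cosh hc.ne'
    simp only [Real.tanh_eq_sinh_div_cosh]
    convert! h1 using 1
    have := Real.cosh_sq (√3 / 2 * x)
    field_simp
  have := h.ofReal_comp
  unfold kink
  convert! this using 1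
  push_cast
  ring

theorem norm_kink_le (x : ℝ) : ‖kink x‖ ≤ 1 := by
  rw [kink, Complex.norm_real, Real.norm_eq_abs]
  exact (Real.abs_tanh_lt_one _).le

/-- By the Riccati equation T' = (√3/2)(1 - T²), polynomials in T are stable under differentiation,
and they are bounded because |T| ≤ 1. -/
theorem hasTemperateGrowth_kink : kink.HasTemperateGrowth := by
  let A : Set (ℝ → ℂ) := {f | ∃ q : Polynomial ℂ, f = fun x : ℝ => q.eval (kink x)}
  refine hasTemperateGrowth_of_closed (A := A) ?_ ?_ ⟨Polynomial.X, by simp⟩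
  · rintro f ⟨q, rfl⟩
    refine ⟨_, ⟨q.derivative * (Polynomial.C (((√3 : ℝ) : ℂ) / 2) * (1 - Polynomial.X ^ 2)), rfl⟩,
      fun x => ?_⟩
    convert! (q.hasDerivAt (kink x)).comp x (hasDerivAt_kink x) using 1
    simp
  · rintro f ⟨q, rfl⟩
    obtain ⟨C, hC⟩ := (isCompact_closedBall (0 : ℂ) 1).exists_bound_of_continuousOn
      (q.continuous.continuousOn)
    exact ⟨0, C, fun x => by simpa using hC (kink x) (by simpa using norm_kink_le x)⟩

theorem exists_one_add_pow_mul_exp_neg_le {δ : ℝ} (hδ : 0 < δ) (k : ℕ) :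
    ∃ C : ℝ, ∀ x : ℝ, (1 + ‖x‖) ^ k * Real.exp (-(δ * ‖x‖)) ≤ C := by
  refine ⟨(δ⁻¹) ^ k * (k.factorial * Real.exp δ), fun x => ?_⟩
  have h := Real.pow_div_factorial_le_exp (δ * (1 + ‖x‖)) (by positivity) k
  rw [div_le_iff₀ (by positivity), mul_pow] at h
  have h1 : (1 + ‖x‖) ^ k ≤ (δ⁻¹) ^ k * (Real.exp (δ * (1 + ‖x‖)) * k.factorial) := by
    calc (1 + ‖x‖) ^ k = (δ⁻¹) ^ k * (δ ^ k * (1 + ‖x‖) ^ k) := by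
          rw [← mul_assoc, ← mul_pow, inv_mul_cancel₀ hδ.ne', one_pow, one_mul]
      _ ≤ _ := by gcongr
  calc (1 + ‖x‖) ^ k * Real.exp (-(δ * ‖x‖))
      ≤ (δ⁻¹) ^ k * (Real.exp (δ * (1 + ‖x‖)) * k.factorial) * Real.exp (-(δ * ‖x‖)) := by gcongr
    _ = (δ⁻¹) ^ k * (k.factorial * (Real.exp (δ * (1 + ‖x‖)) * Real.exp (-(δ * ‖x‖)))) := by ring
    _ = _ := by rw [← Real.exp_add]; ring_nf

/-- The weighted soliton profile `e^{ax} sech²(√3 x / 2)`. -/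
def expSoliton (a x : ℝ) : ℝ := Real.exp (a * x) * soliton x

theorem soliton_pos (x : ℝ) : 0 < soliton x := by
  have := Real.cosh_pos (√3 * x / 2)
  unfold soliton
  positivity

theorem expSoliton_pos (a x : ℝ) : 0 < expSoliton a x :=
  mul_pos (Real.exp_pos _) (soliton_pos x)

theorem ofReal_soliton (x : ℝ) : ((soliton x : ℝ) : ℂ) = 1 - kink x ^ 2 := by
  have h : soliton x = 1 - Real.tanh (√3 / 2 * x) ^ 2 := by
    have hc := Real.cosh_pos (√3 / 2 * x)
    have := Real.cosh_sq (√3 / 2 * x)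
    rw [soliton, Real.tanh_eq_sinh_div_cosh, show √3 * x / 2 = √3 / 2 * x by ring,
      div_pow, div_pow, one_pow, eq_sub_iff_add_eq, ← add_div, div_eq_one_iff_eq (by positivity)]
    linarith
  rw [h, kink]
  push_cast
  ring

theorem hasDerivAt_expSoliton (a x : ℝ) :
    HasDerivAt (fun x => ((expSoliton a x : ℝ) : ℂ))
      (((a : ℂ) - ((√3 : ℝ) : ℂ) * kink x) * ((expSoliton a x : ℝ) : ℂ)) x := by
  have h0 : HasDerivAt (fun x : ℝ => ((Real.exp (a * x) : ℝ) : ℂ))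
      ((a : ℂ) * ((Real.exp (a * x) : ℝ) : ℂ)) x := by
    have h := (((hasDerivAt_id x).const_mul a).exp).ofReal_comp
    simp only [id] at h
    convert! h using 1
    push_cast
    ring
  have h1 : HasDerivAt (fun x : ℝ => ((soliton x : ℝ) : ℂ))
      (-((√3 : ℝ) : ℂ) * kink x * (1 - kink x ^ 2)) x := by
    simp only [ofReal_soliton]
    convert! ((hasDerivAt_kink x).pow 2).const_sub 1 using 1
    push_cast
    ring
  simp only [expSoliton, Complex.ofReal_mul]
  convert! h0.mul h1 using 1
  rw [ofReal_soliton]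
  push_cast
  ring

theorem soliton_le (x : ℝ) : soliton x ≤ 4 * Real.exp (-(√3 * ‖x‖)) := by
  have hc := Real.cosh_pos (√3 * x / 2)
  have h : Real.exp (√3 * ‖x‖ / 2) ≤ 2 * Real.cosh (√3 * x / 2) := by
    have h1 : Real.cosh (√3 * x / 2) = Real.cosh (√3 * ‖x‖ / 2) := by
      rw [← Real.cosh_abs, abs_div, abs_mul, abs_of_nonneg (Real.sqrt_nonneg 3)]
      simp
    rw [h1, Real.cosh_eq]
    have := Real.exp_pos (-(√3 * ‖x‖ / 2))
    linarith
  have h2 : Real.exp (√3 * ‖x‖) ≤ 4 * Real.cosh (√3 * x / 2) ^ 2 := by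
    calc _ = Real.exp (√3 * ‖x‖ / 2) ^ 2 := by rw [← Real.exp_nat_mul]; ring_nf
      _ ≤ (2 * Real.cosh (√3 * x / 2)) ^ 2 := by gcongr
      _ = _ := by ring
  rw [soliton, Real.exp_neg, div_pow, one_pow, ← div_eq_mul_inv,
    div_le_div_iff₀ (by positivity) (by positivity)]
  linarith

/-- The profile decays like e^{-(√3-|a|)|x|} and has logarithmic derivative a - √3 T, of temperate
growth. -/
theorem exists_schwartzMap_expSoliton {a : ℝ} (ha : |a| < √3) :
    ∃ g : 𝓢(ℝ, ℂ), ⇑g = fun x => ((expSoliton a x : ℝ) : ℂ) := by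
  refine exists_schwartzMap_of_hasDerivAt (h := fun x => (a : ℂ) - ((√3 : ℝ) : ℂ) * kink x) ?_
    (hasDerivAt_expSoliton a) fun k => ?_
  · have := hasTemperateGrowth_kink
    fun_prop
  · obtain ⟨C, hC⟩ := exists_one_add_pow_mul_exp_neg_le (sub_pos.2 ha) k
    refine ⟨4 * C, fun x => ?_⟩
    rw [Complex.norm_real, Real.norm_of_nonneg (expSoliton_pos a x).le, expSoliton]
    have h1 : Real.exp (a * x) ≤ Real.exp (|a| * ‖x‖) := by
      rw [Real.exp_le_exp, Real.norm_eq_abs, ← abs_mul]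
      exact le_abs_self _
    calc (1 + ‖x‖) ^ k * (Real.exp (a * x) * soliton x)
        ≤ (1 + ‖x‖) ^ k * (Real.exp (|a| * ‖x‖) * (4 * Real.exp (-(√3 * ‖x‖)))) := by
          have := (soliton_pos x).le
          gcongr
          exact soliton_le x
      _ = 4 * ((1 + ‖x‖) ^ k * Real.exp (-((√3 - |a|) * ‖x‖))) := by
          rw [show -((√3 - |a|) * ‖x‖) = |a| * ‖x‖ + -(√3 * ‖x‖) by ring, Real.exp_add]
          ring
      _ ≤ 4 * C := by gcongr; exact hC x

/-- The profile `e^{ax} sech²(√3 x / 2)`, as a Schwartz function. -/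
def expSolitonMap {a : ℝ} (ha : |a| < √3) : 𝓢(ℝ, ℂ) := (exists_schwartzMap_expSoliton ha).choose

@[simp]
theorem expSolitonMap_apply {a : ℝ} (ha : |a| < √3) (x : ℝ) :
    expSolitonMap ha x = ((expSoliton a x : ℝ) : ℂ) :=
  congrFun (exists_schwartzMap_expSoliton ha).choose_spec x

/-! ### Differential operators on Schwartz functions -/

/-- The operator `d/dx + a`. -/
def shiftDeriv (a : ℂ) : 𝓢(ℝ, ℂ) →L[ℂ] 𝓢(ℝ, ℂ) :=
  derivCLM ℂ ℂ + a • ContinuousLinearMap.id ℂ _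

/-- Multiplication by `tanh (√3 x / 2)`. -/
def mulKink : 𝓢(ℝ, ℂ) →L[ℂ] 𝓢(ℝ, ℂ) := smulLeftCLM ℂ kink

@[simp]
theorem shiftDeriv_apply (a : ℂ) (φ : 𝓢(ℝ, ℂ)) (x : ℝ) :
    shiftDeriv a φ x = deriv φ x + a * φ x := by
  simp [shiftDeriv]

@[simp]
theorem mulKink_apply (φ : 𝓢(ℝ, ℂ)) (x : ℝ) : mulKink φ x = kink x * φ x := by
  simp [mulKink, smulLeftCLM_apply_apply hasTemperateGrowth_kink]

theorem shiftDeriv_mulKink (a : ℂ) (φ : 𝓢(ℝ, ℂ)) :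
    shiftDeriv a (mulKink φ) =
      (((√3 : ℝ) : ℂ) / 2) • (φ - mulKink (mulKink φ)) + mulKink (shiftDeriv a φ) := by
  ext x
  have h : deriv (mulKink φ) x =
      ((√3 : ℝ) : ℂ) / 2 * (1 - kink x ^ 2) * φ x + kink x * deriv φ x := by
    rw [show ⇑(mulKink φ) = fun x => kink x * φ x from funext (mulKink_apply φ)]
    exact ((hasDerivAt_kink x).mul (φ.hasDerivAt x)).deriv
  simp only [shiftDeriv_apply, add_apply, smul_apply, sub_apply, mulKink_apply, h, smul_eq_mul]
  ring

/-- The operator `-½ D + ⅙ D³`, `D = d/dx + a`. -/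
def freeOp (a : ℂ) : 𝓢(ℝ, ℂ) →L[ℂ] 𝓢(ℝ, ℂ) :=
  -(1 / 2 : ℂ) • shiftDeriv a + (1 / 6 : ℂ) • (shiftDeriv a ∘L shiftDeriv a ∘L shiftDeriv a)

/-- The operator `-½ D + ⅙ D³ + 3/2 Θ D`, `D = d/dx + a`. -/
def solitonOp (a : ℂ) : 𝓢(ℝ, ℂ) →L[ℂ] 𝓢(ℝ, ℂ) :=
  freeOp a + (3 / 2 : ℂ) • (shiftDeriv a - mulKink ∘L mulKink ∘L shiftDeriv a)

/-- The second order operator intertwining `freeOp` and `solitonOp`. -/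
def darbouxOp (a : ℂ) : 𝓢(ℝ, ℂ) →L[ℂ] 𝓢(ℝ, ℂ) :=
  shiftDeriv a ∘L shiftDeriv a - (2 * ((√3 : ℝ) : ℂ)) • (mulKink ∘L shiftDeriv a) +
    (3 : ℂ) • (mulKink ∘L mulKink)

theorem ofReal_sqrt_three_sq : ((√3 : ℝ) : ℂ) ^ 2 = 3 := by
  rw [← Complex.ofReal_pow, Real.sq_sqrt (by norm_num)]
  norm_num

/-- The Darboux intertwining. It is a formal identity in D and T that follows from the commutation
rule D T = T D + (√3/2)(1 - T²). -/
theorem solitonOp_darbouxOp (a : ℂ) (φ : 𝓢(ℝ, ℂ)) :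
    solitonOp a (darbouxOp a φ) = darbouxOp a (freeOp a φ) := by
  -- Writing the constants as powers of s = √3 makes the identity homogeneous; it then holds for
  -- every s, with no use of s² = 3.
  have h3 := ofReal_sqrt_three_sq.symm
  have h1 : (1 / 2 : ℂ) = ((√3 : ℝ) : ℂ) ^ 2 / 6 := by rw [← h3]; norm_num
  have h2 : (3 / 2 : ℂ) = ((√3 : ℝ) : ℂ) ^ 2 / 2 := by rw [← h3]
  rw [solitonOp, darbouxOp, freeOp, h1, h2, h3]
  generalize hs : ((√3 : ℝ) : ℂ) = s
  have hD := shiftDeriv_mulKink a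
  rw [hs] at hD
  simp only [_root_.add_apply, _root_.sub_apply, _root_.smul_apply,
    ContinuousLinearMap.comp_apply, map_add, map_sub, map_smul, hD]
  module

/-! ### The range of the intertwining operator -/

theorem exists_primitive_hasCompactSupport {q : ℝ → ℂ} (hq : ContDiff ℝ ∞ q)
    (hc : HasCompactSupport q) (h0 : ∫ x, q x = 0) :
    ∃ Q : ℝ → ℂ, ContDiff ℝ ∞ Q ∧ HasCompactSupport Q ∧ ∀ x, HasDerivAt Q (q x) x := by
  obtain ⟨R, hR⟩ := hc.isCompact.isBounded.subset_closedBall (0 : ℝ)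
  have hsupp : ∀ x, q x ≠ 0 → |x| ≤ R := fun x hx => by
    simpa using hR (subset_tsupport q hx)
  -- The base point lies to the left of the support, so the primitive vanishes there; beyond the
  -- support it equals the total integral, which is 0.
  have hd : ∀ x, HasDerivAt (fun x => ∫ t in (-R - 1)..x, q t) (q x) x := fun x =>
    intervalIntegral.integral_hasDerivAt_right (hq.continuous.intervalIntegrable _ _)
      (hq.continuous.stronglyMeasurableAtFilter _ _) hq.continuous.continuousAt
  refine ⟨fun x => ∫ t in (-R - 1)..x, q t, ?_, ?_, hd⟩
  · rw [contDiff_infty_iff_deriv]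
    refine ⟨fun x => (hd x).differentiableAt, ?_⟩
    rwa [show deriv _ = q from funext fun x => (hd x).deriv]
  · refine HasCompactSupport.intro (isCompact_Icc (a := -R - 1) (b := R)) fun x hx => ?_
    rw [Set.mem_Icc, not_and_or, not_le, not_le] at hx
    rcases hx with hx | hx
    · refine (intervalIntegral.integral_congr (g := fun _ => 0) fun t ht => ?_).trans (by simp)
      by_contra h
      have h1 := (abs_le.1 (hsupp t h)).1
      rw [Set.uIcc_of_ge hx.le] at ht
      linarith [ht.2]
    · rw [intervalIntegral.integral_eq_integral_of_support_subset, h0]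
      intro t ht
      have h1 := abs_le.1 (hsupp t ht)
      exact ⟨by linarith [h1.1], by linarith [h1.2]⟩

/-- The function `(√3 x / 2) tanh (√3 x / 2) - 1`. -/
def kinkCompanion (x : ℝ) : ℂ := ((√3 : ℝ) : ℂ) / 2 * x * kink x - 1

theorem hasDerivAt_kinkCompanion (x : ℝ) : HasDerivAt kinkCompanion
    (((√3 : ℝ) : ℂ) / 2 * kink x + 3 / 4 * x * (1 - kink x ^ 2)) x := by
  have h := (((Complex.ofRealCLM.hasDerivAt (x := x)).const_mul (((√3 : ℝ) : ℂ) / 2)).mul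
    (hasDerivAt_kink x)).sub_const 1
  refine h.congr_deriv ?_
  have h3 := ofReal_sqrt_three_sq
  simp only [Complex.ofRealCLM_apply, Complex.ofReal_one]
  linear_combination (x : ℂ) * (1 - kink x ^ 2) / 4 * h3

theorem hasTemperateGrowth_kinkCompanion : kinkCompanion.HasTemperateGrowth := by
  have h1 := hasTemperateGrowth_kink
  have h2 : (fun x : ℝ => (x : ℂ)).HasTemperateGrowth := Function.Complex.hasTemperateGrowth_ofReal
  unfold kinkCompanion
  fun_prop

/-- Put G = e^{ax}Θ and w = Gφ: the equation becomes w'' + (3/2)Θw = Gg. The homogeneous equation is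
solved by T and `kinkCompanion`, and variation of constants gives w. The two moment conditions make
the primitives involved compactly supported, so dividing by G keeps φ in the Schwartz space. -/
theorem exists_darbouxOp_eq {a : ℝ} (ha : |a| < √3) {g : 𝓢(ℝ, ℂ)} (hg : HasCompactSupport g)
    (h1 : ∫ x, kink x * ((expSoliton a x : ℝ) : ℂ) * g x = 0)
    (h2 : ∫ x, kinkCompanion x * ((expSoliton a x : ℝ) : ℂ) * g x = 0) :
    ∃ φ : 𝓢(ℝ, ℂ), darbouxOp a φ = g := by
  have hs3 := ofReal_sqrt_three_sq
  have hs0 : ((√3 : ℝ) : ℂ) ≠ 0 := fun h => by simp [h] at hs3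
  set G : ℝ → ℂ := fun x => ((expSoliton a x : ℝ) : ℂ) with hG
  have hG0 : ∀ x, G x ≠ 0 := fun x => Complex.ofReal_ne_zero.2 (expSoliton_pos a x).ne'
  have hGs : ContDiff ℝ ∞ G := by
    rw [hG, ← (exists_schwartzMap_expSoliton ha).choose_spec]
    exact SchwartzMap.smooth _ ⊤
  have hT := hasTemperateGrowth_kink.1
  have hS := hasTemperateGrowth_kinkCompanion.1
  have hgs : ContDiff ℝ ∞ g := g.smooth ⊤
  obtain ⟨Q₁, hQ₁s, hQ₁c, hQ₁⟩ := exists_primitive_hasCompactSupport ((hT.mul hGs).mul hgs)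
    hg.mul_left h1
  obtain ⟨Q₂, hQ₂s, hQ₂c, hQ₂⟩ := exists_primitive_hasCompactSupport ((hS.mul hGs).mul hgs)
    hg.mul_left h2
  set s := ((√3 : ℝ) : ℂ) with hs
  -- The factor 2/√3 is the inverse of the constant Wronskian of T and `kinkCompanion`.
  let w : ℝ → ℂ := fun x => 2 / s * (kinkCompanion x * Q₁ x - kink x * Q₂ x)
  let w' : ℝ → ℂ := fun x => 2 / s * ((s / 2 * kink x + 3 / 4 * x * (1 - kink x ^ 2)) * Q₁ x -
    s / 2 * (1 - kink x ^ 2) * Q₂ x)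
  let w'' : ℝ → ℂ := fun x => -(3 / 2) * (1 - kink x ^ 2) * w x + G x * g x
  have hw : ∀ x, HasDerivAt w (w' x) x := fun x => by
    refine ((((hasDerivAt_kinkCompanion x).mul (hQ₁ x)).sub
      ((hasDerivAt_kink x).mul (hQ₂ x))).const_mul (2 / s)).congr_deriv ?_
    simp only [w']
    ring
  have hw' : ∀ x, HasDerivAt w' (w'' x) x := fun x => by
    have hx : HasDerivAt (fun x : ℝ => (x : ℂ)) 1 x := by
      exact (Complex.ofRealCLM.hasDerivAt (x := x)).congr_deriv (by simp)
    have hθ : HasDerivAt (fun x => 1 - kink x ^ 2) (-(2 * kink x * (s / 2 * (1 - kink x ^ 2)))) x := by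
      convert! ((hasDerivAt_kink x).pow 2).const_sub 1 using 1
      simp [hs]
    have h3 := ((((hasDerivAt_kink x).const_mul (s / 2)).add ((hx.const_mul (3 / 4)).mul hθ)).mul
      (hQ₁ x)).sub ((hθ.const_mul (s / 2)).mul (hQ₂ x))
    refine (h3.const_mul (2 / s)).congr_deriv ?_
    simp only [w'', w, kinkCompanion, Pi.mul_apply, Pi.add_apply, ← hs]
    field_simp
    rw [← sub_eq_zero]
    ring_nf
    rw [hs3]
    ring
  have hGi : ∀ x, HasDerivAt (fun x => (G x)⁻¹) (-((a : ℂ) - s * kink x) * (G x)⁻¹) x := fun x => by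
    refine ((hasDerivAt_expSoliton a x).inv (hG0 x)).congr_deriv ?_
    have := hG0 x
    simp only [hG] at this ⊢
    rw [← hs]
    field_simp
  have hφs : ContDiff ℝ ∞ fun x => w x * (G x)⁻¹ :=
    (contDiff_const.mul ((hS.mul hQ₁s).sub (hT.mul hQ₂s))).mul (hGs.inv hG0)
  have hφc : HasCompactSupport fun x => w x * (G x)⁻¹ := by
    refine HasCompactSupport.mul_right (HasCompactSupport.mul_left ?_)
    exact HasCompactSupport.sub (hQ₁c.mul_left) (hQ₂c.mul_left)
  refine ⟨hφc.toSchwartzMap hφs, ?_⟩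
  set φ := hφc.toSchwartzMap hφs with hφ
  have hφ0 : ∀ x, φ x = w x * (G x)⁻¹ := fun x => rfl
  have hφ1 : ∀ x, shiftDeriv a φ x = (w' x + s * kink x * w x) * (G x)⁻¹ := fun x => by
    have h := ((hw x).mul (hGi x)).deriv
    rw [shiftDeriv_apply, hφ0, show ⇑φ = fun x => w x * (G x)⁻¹ from rfl]
    erw [h]
    ring
  have hφ2 : ∀ x, shiftDeriv a (shiftDeriv a φ) x = (w'' x + s * (s / 2 * (1 - kink x ^ 2)) * w x +
      s * kink x * w' x + s * kink x * (w' x + s * kink x * w x)) * (G x)⁻¹ := fun x => by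
    have h := (((hw' x).add (((hasDerivAt_kink x).const_mul s).mul (hw x))).mul (hGi x)).deriv
    rw [shiftDeriv_apply, hφ1, show ⇑(shiftDeriv (a : ℂ) φ) =
      fun x => (w' x + s * kink x * w x) * (G x)⁻¹ from funext hφ1]
    erw [h]
    simp only [Pi.mul_apply, Pi.add_apply]
    ring
  ext x
  simp only [darbouxOp, _root_.add_apply, _root_.sub_apply, _root_.smul_apply, add_apply, sub_apply,
    smul_apply, ContinuousLinearMap.comp_apply, mulKink_apply, hφ0, hφ1, hφ2, smul_eq_mul, ← hs, w'']
  have := hG0 x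
  field_simp
  rw [← sub_eq_zero]
  ring_nf
  rw [hs3]
  ring

/-! ### Pairing of square integrable functions with Schwartz functions -/

/-- The bilinear pairing `(φ, f) ↦ ∫ φ f` of Schwartz functions and square integrable functions. -/
def schwartzPairing : 𝓢(ℝ, ℂ) →L[ℂ] Lp ℂ 2 (volume : Measure ℝ) →L[ℂ] ℂ :=
  (ContinuousLinearMap.mul ℂ ℂ).lpPairing volume 2 2 ∘L toLpCLM ℂ ℂ 2 volume

theorem schwartzPairing_apply (φ : 𝓢(ℝ, ℂ)) (f : Lp ℂ 2 (volume : Measure ℝ)) :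
    schwartzPairing φ f = ∫ x, φ x * f x := by
  rw [schwartzPairing, ContinuousLinearMap.comp_apply, ContinuousLinearMap.lpPairing_eq_integral]
  refine integral_congr_ae ?_
  filter_upwards [φ.coeFn_toLp 2 volume] with x hx
  simp [hx]

theorem schwartzPairing_toLp (φ ψ : 𝓢(ℝ, ℂ)) :
    schwartzPairing φ (ψ.toLp 2 volume) = ∫ x, φ x * ψ x := by
  rw [schwartzPairing_apply]
  refine integral_congr_ae ?_
  filter_upwards [ψ.coeFn_toLp 2 volume] with x hx
  rw [hx]

theorem eq_zero_of_schwartzPairing_eq_zero {f : Lp ℂ 2 (volume : Measure ℝ)}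
    (h : ∀ φ : 𝓢(ℝ, ℂ), HasCompactSupport φ → schwartzPairing φ f = 0) : f = 0 := by
  rw [Lp.eq_zero_iff_ae_eq_zero]
  refine ae_eq_zero_of_integral_contDiff_smul_eq_zero
    ((Lp.memLp f).locallyIntegrable (by norm_num)) fun g hg hgc => ?_
  have hc : HasCompactSupport fun x => (g x : ℂ) := hgc.comp_left (g := ((↑) : ℝ → ℂ)) rfl
  have hs : ContDiff ℝ ∞ fun x => (g x : ℂ) := Complex.ofRealCLM.contDiff.comp hg
  have := h (hc.toSchwartzMap hs) hc
  rw [schwartzPairing_apply] at this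
  simpa using this

theorem schwartzPairing_fourierInv (φ : 𝓢(ℝ, ℂ)) (f : Lp ℂ 2 (volume : Measure ℝ)) :
    schwartzPairing φ ((Lp.fourierTransformₗᵢ ℝ ℂ).symm f) = schwartzPairing (𝓕⁻ φ) f := by
  have h : ∀ (ψ : 𝓢(ℝ, ℂ)) (g : Lp ℂ 2 (volume : Measure ℝ)),
      schwartzPairing ψ g = Lp.toTemperedDistribution g ψ := fun ψ g => by
    rw [schwartzPairing_apply, Lp.toTemperedDistribution_apply]
    simp
  rw [h, h, ← TemperedDistribution.fourierInv_apply, Lp.fourierInv_toTemperedDistribution_eq]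
  rfl

theorem schwartzPairing_fourier (φ : 𝓢(ℝ, ℂ)) (f : Lp ℂ 2 (volume : Measure ℝ)) :
    schwartzPairing φ (Lp.fourierTransformₗᵢ ℝ ℂ f) = schwartzPairing (𝓕 φ) f := by
  have h := schwartzPairing_fourierInv (𝓕 φ) (Lp.fourierTransformₗᵢ ℝ ℂ f)
  rw [LinearIsometryEquiv.symm_apply_apply, FourierTransform.fourierInv_fourier_eq] at h
  exact h.symm

/-! ### The generalized kernel -/

section Kernel

variable {a : ℝ} (ha : |a| < √3)

/-- The function `e^{ax} Θ(x) tanh (√3 x / 2)`, proportional to `e^{ax} Θ'`. -/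
def solitonDeriv : 𝓢(ℝ, ℂ) := mulKink (expSolitonMap ha)

/-- The function `e^{ax} Θ(x) ((√3 x / 2) tanh (√3 x / 2) - 1)`, proportional to the derivative of
the soliton with respect to its speed, times `e^{ax}`. -/
def solitonSpeedDeriv : 𝓢(ℝ, ℂ) := smulLeftCLM ℂ kinkCompanion (expSolitonMap ha)

@[simp]
theorem solitonDeriv_apply (x : ℝ) :
    solitonDeriv ha x = kink x * ((expSoliton a x : ℝ) : ℂ) := by
  simp [solitonDeriv]

@[simp]
theorem solitonSpeedDeriv_apply (x : ℝ) :
    solitonSpeedDeriv ha x = kinkCompanion x * ((expSoliton a x : ℝ) : ℂ) := by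
  simp [solitonSpeedDeriv, smulLeftCLM_apply_apply hasTemperateGrowth_kinkCompanion]

/-- A function orthogonal to the range of the intertwining operator lies in the generalized
kernel. -/
theorem exists_eq_add_of_darbouxOp {f : Lp ℂ 2 (volume : Measure ℝ)}
    (hf : ∀ φ, schwartzPairing (darbouxOp a φ) f = 0) :
    ∃ c d : ℂ, f = c • (solitonDeriv ha).toLp 2 volume + d • (solitonSpeedDeriv ha).toLp 2 volume := by
  let V : Submodule ℂ 𝓢(ℝ, ℂ) :=
    { carrier := {φ | HasCompactSupport φ}
      add_mem' := fun h₁ h₂ => HasCompactSupport.add h₁ h₂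
      zero_mem' := HasCompactSupport.zero
      smul_mem' := fun c φ h => HasCompactSupport.smul_left (f := fun _ => c) h }
  let ℓ : Lp ℂ 2 (volume : Measure ℝ) → V →ₗ[ℂ] ℂ := fun g =>
    (ContinuousLinearMap.apply ℂ ℂ g).toLinearMap ∘ₗ schwartzPairing.toLinearMap ∘ₗ V.subtype
  have hℓ : ∀ g φ, ℓ g φ = schwartzPairing φ.1 g := fun _ _ => rfl
  let L : Fin 2 → V →ₗ[ℂ] ℂ :=
    ![ℓ ((solitonDeriv ha).toLp 2 volume), ℓ ((solitonSpeedDeriv ha).toLp 2 volume)]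
  -- A functional that vanishes on the common kernel of finitely many functionals is a combination
  -- of them; on that kernel the test function is in the range of `darbouxOp`.
  have hspan : ℓ f ∈ Submodule.span ℂ (Set.range L) := by
    refine mem_span_of_iInf_ker_le_ker fun φ hφ => ?_
    simp only [Submodule.mem_iInf, LinearMap.mem_ker, Fin.forall_fin_two] at hφ
    simp only [L, Matrix.cons_val_zero, Matrix.cons_val_one, hℓ, schwartzPairing_toLp] at hφ
    obtain ⟨ψ, hψ⟩ := exists_darbouxOp_eq ha φ.2
      (by rw [← hφ.1]; congr 1; ext x; simp; ring) (by rw [← hφ.2]; congr 1; ext x; simp; ring)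
    rw [LinearMap.mem_ker, hℓ, ← hψ, hf]
  obtain ⟨c, hc⟩ := (Submodule.mem_span_range_iff_exists_fun ℂ).1 hspan
  refine ⟨c 0, c 1, ?_⟩
  rw [← sub_eq_zero]
  refine eq_zero_of_schwartzPairing_eq_zero fun φ hφ => ?_
  have h := LinearMap.congr_fun hc ⟨φ, hφ⟩
  simp only [Fin.sum_univ_two, LinearMap.add_apply, LinearMap.smul_apply, L, hℓ,
    Matrix.cons_val_zero, Matrix.cons_val_one] at h
  rw [map_sub, map_add, map_smul, map_smul, ← h, sub_self]

theorem integral_mul_shiftDeriv (b : ℂ) (φ ψ : 𝓢(ℝ, ℂ)) :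
    ∫ x, shiftDeriv b φ x * ψ x = -∫ x, φ x * shiftDeriv (-b) ψ x := by
  have h := integral_mul_deriv_eq_neg_deriv_mul φ ψ
  have hi : ∀ u v : 𝓢(ℝ, ℂ), Integrable fun x => u x * v x := fun u v =>
    (SchwartzMap.pairing (ContinuousLinearMap.mul ℂ ℂ) u v).integrable
  have hd : ∀ u : 𝓢(ℝ, ℂ), ∀ x, deriv u x = derivCLM ℂ ℂ u x := fun u x => rfl
  simp only [shiftDeriv_apply, hd, add_mul, mul_add] at h ⊢
  rw [integral_add (hi _ _), integral_add (hi _ _)]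
  · have h1 : ∀ x, φ x * (-b * ψ x) = -(b * φ x * ψ x) := fun x => by ring
    simp only [h1, integral_neg, h]
    ring
  · exact ((hi φ ψ).const_mul (-b)).congr (by filter_upwards with x; ring)
  · exact ((hi φ ψ).const_mul b).congr (by filter_upwards with x; ring)

theorem integral_mulKink_mul (φ ψ : 𝓢(ℝ, ℂ)) :
    ∫ x, mulKink φ x * ψ x = ∫ x, φ x * mulKink ψ x := by
  congr 1
  ext x
  simp only [mulKink_apply]
  ring

/-- The transpose of `solitonOp`. -/
def solitonOpTranspose (b : ℂ) : 𝓢(ℝ, ℂ) →L[ℂ] 𝓢(ℝ, ℂ) :=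
  (1 / 2 : ℂ) • shiftDeriv b - (1 / 6 : ℂ) • (shiftDeriv b ∘L shiftDeriv b ∘L shiftDeriv b) -
    (3 / 2 : ℂ) • (shiftDeriv b - shiftDeriv b ∘L mulKink ∘L mulKink)

theorem integral_mul_eq_schwartzPairing (φ ψ : 𝓢(ℝ, ℂ)) :
    ∫ x, φ x * ψ x = schwartzPairing φ (toLpCLM ℂ ℂ 2 volume ψ) :=
  (schwartzPairing_toLp φ ψ).symm

/-- Integration by parts turns d/dx + b into -(d/dx - b), whence the parameter -b. -/
theorem integral_solitonOp_mul (b : ℂ) (φ ψ : 𝓢(ℝ, ℂ)) :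
    ∫ x, solitonOp b φ x * ψ x = ∫ x, φ x * solitonOpTranspose (-b) ψ x := by
  have hD := integral_mul_shiftDeriv b
  have hX := integral_mulKink_mul
  simp only [integral_mul_eq_schwartzPairing] at hD hX ⊢
  simp only [solitonOp, freeOp, solitonOpTranspose, _root_.add_apply, _root_.sub_apply,
    _root_.smul_apply, ContinuousLinearMap.comp_apply, map_add, map_sub, map_smul, hD, hX, neg_neg]
  simp only [smul_eq_mul]
  ring

/-- Multiplication by the variable. -/
def mulVar : 𝓢(ℝ, ℂ) →L[ℂ] 𝓢(ℝ, ℂ) := smulLeftCLM ℂ fun x : ℝ => (x : ℂ)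

@[simp]
theorem mulVar_apply (φ : 𝓢(ℝ, ℂ)) (x : ℝ) : mulVar φ x = x * φ x := by
  have h : (fun x : ℝ => (x : ℂ)).HasTemperateGrowth := Function.Complex.hasTemperateGrowth_ofReal
  simp [mulVar, smulLeftCLM_apply_apply h]

theorem shiftDeriv_mulVar (b : ℂ) (φ : 𝓢(ℝ, ℂ)) :
    shiftDeriv b (mulVar φ) = φ + mulVar (shiftDeriv b φ) := by
  ext x
  have hx : HasDerivAt (fun x : ℝ => (x : ℂ)) 1 x :=
    (Complex.ofRealCLM.hasDerivAt (x := x)).congr_deriv (by simp)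
  have h : deriv (mulVar φ) x = 1 * φ x + x * deriv φ x := by
    rw [show ⇑(mulVar φ) = fun x : ℝ => (x : ℂ) * φ x from funext (mulVar_apply φ)]
    exact (hx.mul (φ.hasDerivAt x)).deriv
  simp only [shiftDeriv_apply, add_apply, mulVar_apply, h]
  ring

theorem mulKink_mulVar (φ : 𝓢(ℝ, ℂ)) : mulKink (mulVar φ) = mulVar (mulKink φ) := by
  ext x
  simp only [mulVar_apply, mulKink_apply]
  ring

theorem shiftDeriv_expSolitonMap :
    shiftDeriv (-a : ℂ) (expSolitonMap ha) = -((√3 : ℝ) : ℂ) • mulKink (expSolitonMap ha) := by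
  ext x
  have h : deriv (expSolitonMap ha) x =
      ((a : ℂ) - ((√3 : ℝ) : ℂ) * kink x) * ((expSoliton a x : ℝ) : ℂ) := by
    rw [show ⇑(expSolitonMap ha) = fun x => ((expSoliton a x : ℝ) : ℂ) from
      funext (expSolitonMap_apply ha)]
    exact (hasDerivAt_expSoliton a x).deriv
  simp only [shiftDeriv_apply, h, smul_apply, mulKink_apply, expSolitonMap_apply, smul_eq_mul]
  ring

theorem solitonSpeedDeriv_eq : solitonSpeedDeriv ha =
    (((√3 : ℝ) : ℂ) / 2) • mulVar (mulKink (expSolitonMap ha)) - expSolitonMap ha := by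
  ext x
  simp only [solitonSpeedDeriv_apply, sub_apply, smul_apply, mulVar_apply, mulKink_apply,
    expSolitonMap_apply, smul_eq_mul, kinkCompanion]
  ring

theorem solitonOpTranspose_solitonDeriv : solitonOpTranspose (-a) (solitonDeriv ha) = 0 := by
  have h3 := ofReal_sqrt_three_sq.symm
  have h1 : (1 / 2 : ℂ) = ((√3 : ℝ) : ℂ) ^ 2 / 6 := by rw [← h3]; norm_num
  have h2 : (3 / 2 : ℂ) = ((√3 : ℝ) : ℂ) ^ 2 / 2 := by rw [← h3]
  have hG := shiftDeriv_expSolitonMap ha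
  have hD := shiftDeriv_mulKink (-a)
  rw [solitonDeriv, solitonOpTranspose, h1, h2]
  generalize ((√3 : ℝ) : ℂ) = s at hG hD ⊢
  simp only [_root_.sub_apply, _root_.smul_apply, hG,
    ContinuousLinearMap.comp_apply, map_add, map_sub, map_smul, hD]
  module

/-- The nonzero coefficient makes the generalized kernel a genuine Jordan block: the speed
derivative is mapped to a multiple of the position derivative. -/
theorem solitonOpTranspose_solitonSpeedDeriv :
    solitonOpTranspose (-a) (solitonSpeedDeriv ha) =
      -(((√3 : ℝ) : ℂ) / 2) • solitonDeriv ha := by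
  have h3 := ofReal_sqrt_three_sq.symm
  have h1 : (1 / 2 : ℂ) = ((√3 : ℝ) : ℂ) ^ 2 / 6 := by rw [← h3]; norm_num
  have h2 : (3 / 2 : ℂ) = ((√3 : ℝ) : ℂ) ^ 2 / 2 := by rw [← h3]
  -- The factor is written with degree three in √3, to match the homogeneity of the third order
  -- operator.
  have h4 : -(((√3 : ℝ) : ℂ) / 2) = -((√3 : ℝ) : ℂ) ^ 3 / 6 := by
    linear_combination (-((√3 : ℝ) : ℂ) / 6) * h3
  have hG := shiftDeriv_expSolitonMap ha
  have hD := shiftDeriv_mulKink (-a)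
  rw [solitonSpeedDeriv_eq, solitonDeriv, solitonOpTranspose, h1, h2, h4]
  generalize ((√3 : ℝ) : ℂ) = s at hG hD ⊢
  simp only [_root_.sub_apply, _root_.smul_apply, hG, shiftDeriv_mulVar,
    mulKink_mulVar, ContinuousLinearMap.comp_apply, map_add, map_sub, map_smul, hD]
  module

theorem schwartzPairing_solitonOp_solitonDeriv (φ : 𝓢(ℝ, ℂ)) :
    schwartzPairing (solitonOp a φ) ((solitonDeriv ha).toLp 2 volume) = 0 := by
  rw [schwartzPairing_toLp, integral_solitonOp_mul, solitonOpTranspose_solitonDeriv]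
  simp

theorem schwartzPairing_solitonOp_solitonSpeedDeriv (φ : 𝓢(ℝ, ℂ)) :
    schwartzPairing (solitonOp a φ) ((solitonSpeedDeriv ha).toLp 2 volume) =
      -(((√3 : ℝ) : ℂ) / 2) * schwartzPairing φ ((solitonDeriv ha).toLp 2 volume) := by
  rw [schwartzPairing_toLp, integral_solitonOp_mul, solitonOpTranspose_solitonSpeedDeriv,
    schwartzPairing_toLp, ← integral_const_mul]
  congr 1
  ext x
  simp only [smul_apply, smul_eq_mul]
  ring

theorem schwartzPairing_solitonOp_solitonOp (ha : |a| < √3) {f : Lp ℂ 2 (volume : Measure ℝ)}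
    (hf : ∀ φ, schwartzPairing (darbouxOp a φ) f = 0) (φ : 𝓢(ℝ, ℂ)) :
    schwartzPairing (solitonOp a (solitonOp a φ)) f = 0 := by
  obtain ⟨c, d, rfl⟩ := exists_eq_add_of_darbouxOp ha hf
  rw [map_add, map_smul, map_smul, schwartzPairing_solitonOp_solitonDeriv,
    schwartzPairing_solitonOp_solitonSpeedDeriv, schwartzPairing_solitonOp_solitonDeriv]
  simp

theorem solitonDeriv_ne_zero : (solitonDeriv ha).toLp 2 volume ≠ 0 := by
  intro h
  have h0 : solitonDeriv ha = 0 := by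
    apply SchwartzMap.injective_toLp 2 volume
    refine h.trans ?_
    exact (map_zero (toLpCLM ℂ ℂ 2 (volume : Measure ℝ))).symm
  -- Any point except 0, the zero of the kink, would serve.
  have h1 := solitonDeriv_apply ha 1
  rw [h0, zero_apply, eq_comm, mul_eq_zero, Complex.ofReal_eq_zero] at h1
  rcases h1 with h1 | h1
  · rw [kink, Complex.ofReal_eq_zero] at h1
    have h2 : 0 < Real.sinh (√3 / 2 * 1) := Real.sinh_pos_iff.2 (by positivity)
    rw [Real.tanh_eq_sinh_div_cosh] at h1
    exact (div_pos h2 (Real.cosh_pos _)).ne' h1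
  · exact (expSoliton_pos a 1).ne' h1

end Kernel

/-! ### Multiplication operators -/

theorem coeFn_mulL2 {μ : Measure ℝ} {m : ℝ → ℂ} (hm : MemLp m ∞ μ) (f : Lp ℂ 2 μ) :
    mulL2 μ m f =ᵐ[μ] fun x => m x * f x := by
  rw [mulL2, dif_pos hm]
  filter_upwards [(ContinuousLinearMap.mul ℂ ℂ).coeFn_holder (r := 2) (hm.toLp m) f,
    hm.coeFn_toLp] with x hx hx'
  rw [← hx']
  exact hx

theorem mulL2_eq {μ : Measure ℝ} {m : ℝ → ℂ} (hm : MemLp m ∞ μ) {f g : Lp ℂ 2 μ}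
    (h : ∀ᵐ x ∂μ, g x = m x * f x) : mulL2 μ m f = g := by
  refine Lp.ext ?_
  filter_upwards [coeFn_mulL2 hm f, h] with x h1 h2
  rw [h1, h2]

theorem norm_mulL2_le {μ : Measure ℝ} {m : ℝ → ℂ} (hm : AEStronglyMeasurable m μ) {C : ℝ}
    (hC : ∀ x, ‖m x‖ ≤ C) : ‖mulL2 μ m‖ ≤ C := by
  have hm' : MemLp m ∞ μ := memLp_top_of_bound hm C (.of_forall hC)
  refine ContinuousLinearMap.opNorm_le_bound _ ((norm_nonneg _).trans (hC 0)) fun f => ?_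
  refine Lp.norm_le_mul_norm_of_ae_le_mul ?_
  filter_upwards [coeFn_mulL2 hm' f] with x hx
  rw [hx, norm_mul]
  gcongr
  exact hC x

theorem mulL2_sub_eq_smul {μ : Measure ℝ} {m n r : ℝ → ℂ} (hm : MemLp m ∞ μ) (hn : MemLp n ∞ μ)
    (hr : MemLp r ∞ μ) (c : ℂ) (h : ∀ x, m x - n x = c * r x) :
    mulL2 μ m - mulL2 μ n = c • mulL2 μ r := by
  refine ContinuousLinearMap.ext fun f => Lp.ext ?_
  filter_upwards [coeFn_mulL2 hm f, coeFn_mulL2 hn f, coeFn_mulL2 hr f,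
    Lp.coeFn_sub (mulL2 μ m f) (mulL2 μ n f), Lp.coeFn_smul c (mulL2 μ r f)] with x h1 h2 h3 h4 h5
  rw [_root_.sub_apply, _root_.smul_apply, h4, h5, Pi.sub_apply, Pi.smul_apply,
    h1, h2, h3, smul_eq_mul, ← sub_mul, h, mul_assoc]

/-! ### The symbol -/

/-- The denominator of `kdvSymbol`. -/
def kdvDenom (z k : ℂ) : ℂ := z - 1 / 2 * (Complex.I * k) + 1 / 6 * (Complex.I * k) ^ 3

/-- The point `k + i a`, `k = 2πξ`, at which symbols are evaluated. -/
def shiftedWave (a ξ : ℝ) : ℂ := ((2 * Real.pi * ξ : ℝ) : ℂ) + Complex.I * (a : ℂ)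

theorem kdvSymbol_eq (z k : ℂ) : kdvSymbol z k = (Complex.I * k) / kdvDenom z k := rfl

theorem I_mul_shiftedWave (a ξ : ℝ) :
    Complex.I * shiftedWave a ξ = ((2 * Real.pi * ξ : ℝ) : ℂ) * Complex.I - a := by
  rw [shiftedWave, mul_add, ← mul_assoc, Complex.I_mul_I]
  ring

/-- The bound for the real part of the essential spectrum. -/
def decayRate (a : ℝ) : ℝ := 1 / 2 * a * (1 - a ^ 2 / 3)

/-- This fixes the half-plane: conjugation by the weight moves the zeros z of the denominator to Re
z = -β - (a/2)k² with k = 2πξ, so they stay off Re z > -β. -/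
theorem re_kdvDenom (a : ℝ) (z : ℂ) (ξ : ℝ) : (kdvDenom z (shiftedWave a ξ)).re =
    z.re + decayRate a + a / 2 * (2 * Real.pi * ξ) ^ 2 := by
  rw [kdvDenom, I_mul_shiftedWave, decayRate]
  generalize 2 * Real.pi * ξ = y
  have h : z - 1 / 2 * ((y : ℂ) * Complex.I - a) + 1 / 6 * ((y : ℂ) * Complex.I - a) ^ 3 =
      z + ((a / 2 + a / 2 * y ^ 2 - a ^ 3 / 6 : ℝ) : ℂ) +
        ((-y / 2 + a ^ 2 * y / 2 - y ^ 3 / 6 : ℝ) : ℂ) * Complex.I := by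
    push_cast
    linear_combination ((y : ℂ) ^ 3 * Complex.I / 6 - a * y ^ 2 / 2) * Complex.I_sq
  rw [h, Complex.add_re, Complex.add_re, Complex.re_ofReal_mul, Complex.I_re, Complex.ofReal_re]
  ring

section Symbol

variable {a : ℝ} (ha : 0 < a) {z : ℂ} (hz : -decayRate a < z.re)

theorem le_norm_kdvDenom (a : ℝ) (z : ℂ) (ξ : ℝ) :
    z.re + decayRate a + a / 2 * (2 * Real.pi * ξ) ^ 2 ≤ ‖kdvDenom z (shiftedWave a ξ)‖ := by
  rw [← re_kdvDenom]
  exact Complex.re_le_norm _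

include ha in
theorem le_norm_kdvDenom' (z : ℂ) (ξ : ℝ) :
    z.re + decayRate a ≤ ‖kdvDenom z (shiftedWave a ξ)‖ := by
  have := le_norm_kdvDenom a z ξ
  have h2 : 0 ≤ a / 2 * (2 * Real.pi * ξ) ^ 2 := by positivity
  linarith

include ha hz in
theorem kdvDenom_ne_zero (ξ : ℝ) : kdvDenom z (shiftedWave a ξ) ≠ 0 := by
  have := le_norm_kdvDenom' ha z ξ
  exact norm_pos_iff.1 (by linarith)

theorem continuous_shiftedWave : Continuous (shiftedWave a) := by
  unfold shiftedWave
  fun_prop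

include ha hz in
theorem continuous_inv_kdvDenom : Continuous fun ξ => (kdvDenom z (shiftedWave a ξ))⁻¹ := by
  refine Continuous.inv₀ ?_ (kdvDenom_ne_zero ha hz)
  have := continuous_shiftedWave (a := a)
  unfold kdvDenom
  fun_prop

include ha hz in
theorem continuous_kdvSymbol : Continuous fun ξ => kdvSymbol z (shiftedWave a ξ) := by
  have h1 := continuous_shiftedWave (a := a)
  have h2 := continuous_inv_kdvDenom ha hz
  simp only [kdvSymbol_eq, div_eq_mul_inv]
  fun_prop

include ha hz in
theorem norm_inv_kdvDenom_le (ξ : ℝ) :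
    ‖(kdvDenom z (shiftedWave a ξ))⁻¹‖ ≤ (z.re + decayRate a)⁻¹ := by
  rw [norm_inv]
  exact inv_anti₀ (by linarith) (le_norm_kdvDenom' ha z ξ)

include ha hz in
theorem exists_norm_sq_kdvSymbol_le :
    ∃ C : ℝ, 0 ≤ C ∧ ∀ ξ, ‖kdvSymbol z (shiftedWave a ξ)‖ ^ 2 ≤ C * (1 + ξ ^ 2)⁻¹ := by
  have hδ : 0 < z.re + decayRate a := by linarith
  set δ := z.re + decayRate a with hδ'
  -- Chosen so that 1 + y² ≤ M(δ + (a/2)y²). The quadratic lower bound from the real part suffices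
  -- for square integrability of the symbol.
  set M := δ⁻¹ + 2 / a with hM
  refine ⟨2 * (1 + a ^ 2) * M ^ 2, by positivity, fun ξ => ?_⟩
  have h0 := le_norm_kdvDenom a z ξ
  rw [← hδ'] at h0
  have hξ : ξ ^ 2 ≤ (2 * Real.pi * ξ) ^ 2 := by
    rw [mul_pow]
    have h1 : (1 : ℝ) ≤ (2 * Real.pi) ^ 2 := by
      have := Real.pi_gt_three
      nlinarith
    nlinarith [sq_nonneg ξ]
  have hI : ‖Complex.I * shiftedWave a ξ‖ ^ 2 = (2 * Real.pi * ξ) ^ 2 + a ^ 2 := by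
    rw [I_mul_shiftedWave, ← Complex.normSq_eq_norm_sq, Complex.normSq_apply]
    simp
    ring
  generalize 2 * Real.pi * ξ = y at h0 hξ hI
  have hpos : 0 < δ + a / 2 * y ^ 2 := by positivity
  have h1 : 1 + y ^ 2 ≤ M * (δ + a / 2 * y ^ 2) := by
    have : M * (δ + a / 2 * y ^ 2) = 1 + y ^ 2 + (δ⁻¹ * (a / 2 * y ^ 2) + 2 / a * δ) := by
      rw [hM]; field_simp; ring
    rw [this]
    have : 0 ≤ δ⁻¹ * (a / 2 * y ^ 2) + 2 / a * δ := by positivity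
    linarith
  have h2 : 1 + y ^ 2 ≤ M * ‖kdvDenom z (shiftedWave a ξ)‖ := h1.trans (by gcongr)
  have hn : 0 < ‖kdvDenom z (shiftedWave a ξ)‖ := hpos.trans_le h0
  rw [kdvSymbol_eq, norm_div, div_pow, hI, ← div_eq_mul_inv,
    div_le_div_iff₀ (by positivity) (by positivity)]
  calc (y ^ 2 + a ^ 2) * (1 + ξ ^ 2) ≤ (2 * (1 + a ^ 2) * (1 + y ^ 2)) * (1 + y ^ 2) := by
        gcongr
        nlinarith [sq_nonneg (a * y), sq_nonneg a, sq_nonneg y]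
    _ = 2 * (1 + a ^ 2) * (1 + y ^ 2) ^ 2 := by ring
    _ ≤ 2 * (1 + a ^ 2) * (M * ‖kdvDenom z (shiftedWave a ξ)‖) ^ 2 := by gcongr
    _ = _ := by ring

include ha hz in
theorem exists_norm_kdvSymbol_le : ∃ C : ℝ, ∀ ξ, ‖kdvSymbol z (shiftedWave a ξ)‖ ≤ C := by
  obtain ⟨C, hC0, hC⟩ := exists_norm_sq_kdvSymbol_le ha hz
  refine ⟨√C, fun ξ => Real.le_sqrt_of_sq_le ((hC ξ).trans ?_)⟩
  exact mul_le_of_le_one_right hC0 (inv_le_one_of_one_le₀ (by nlinarith [sq_nonneg ξ]))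

include ha hz in
theorem memLp_top_kdvSymbol :
    MemLp (fun ξ => kdvSymbol z (shiftedWave a ξ)) ∞ (volume : Measure ℝ) := by
  obtain ⟨C, hC⟩ := exists_norm_kdvSymbol_le ha hz
  exact memLp_top_of_bound (continuous_kdvSymbol ha hz).aestronglyMeasurable C (.of_forall hC)

include ha hz in
theorem memLp_top_inv_kdvDenom :
    MemLp (fun ξ => (kdvDenom z (shiftedWave a ξ))⁻¹) ∞ (volume : Measure ℝ) :=
  memLp_top_of_bound (continuous_inv_kdvDenom ha hz).aestronglyMeasurable _
    (.of_forall (norm_inv_kdvDenom_le ha hz))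

include ha hz in
theorem memLp_two_kdvSymbol :
    MemLp (fun ξ => kdvSymbol z (shiftedWave a ξ)) 2 (volume : Measure ℝ) := by
  obtain ⟨C, hC0, hC⟩ := exists_norm_sq_kdvSymbol_le ha hz
  have hm := (continuous_kdvSymbol ha hz).aestronglyMeasurable (μ := volume)
  rw [memLp_two_iff_integrable_sq_norm hm]
  refine (integrable_inv_one_add_sq.const_mul C).mono' (hm.norm.pow 2) (.of_forall fun ξ => ?_)
  simpa using hC ξ

include ha hz in
theorem hasTemperateGrowth_inv_kdvDenom :
    (fun ξ => (kdvDenom z (shiftedWave a ξ))⁻¹).HasTemperateGrowth := by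
  let q : Polynomial ℂ := Polynomial.C (2 * Real.pi * Complex.I) * Polynomial.X - Polynomial.C (a : ℂ)
  let p : Polynomial ℂ := Polynomial.C z - Polynomial.C (1 / 2) * q + Polynomial.C (1 / 6) * q ^ 3
  have hp : ∀ ξ : ℝ, kdvDenom z (shiftedWave a ξ) = p.eval (ξ : ℂ) := fun ξ => by
    have hq : q.eval (ξ : ℂ) = Complex.I * shiftedWave a ξ := by
      rw [I_mul_shiftedWave]
      simp only [q, Polynomial.eval_sub, Polynomial.eval_mul, Polynomial.eval_C, Polynomial.eval_X]
      push_cast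
      ring
    rw [kdvDenom, ← hq]
    simp only [p, Polynomial.eval_sub, Polynomial.eval_add, Polynomial.eval_mul, Polynomial.eval_C,
      Polynomial.eval_pow]
  simp only [hp]
  refine hasTemperateGrowth_inv_polynomial p (δ := z.re + decayRate a) (by linarith) fun ξ => ?_
  rw [← hp]
  exact le_norm_kdvDenom' ha z ξ

/-! ### The free operator on the Fourier side. -/

theorem fourierInv_shiftDeriv (a : ℝ) (φ : 𝓢(ℝ, ℂ)) (ξ : ℝ) :
    𝓕⁻ (shiftDeriv a φ) ξ = -(Complex.I * shiftedWave a ξ) * 𝓕⁻ φ ξ := by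
  have h1 : derivCLM ℂ ℂ φ = LineDeriv.lineDerivOp (1 : ℝ) φ := by
    ext x
    rw [derivCLM_apply, lineDerivOp_apply_eq_fderiv]
    simp
  have hg : (fun x : ℝ => inner ℝ x (1 : ℝ)).HasTemperateGrowth := by fun_prop
  have h2 : 𝓕⁻ (shiftDeriv a φ) = 𝓕⁻ (derivCLM ℂ ℂ φ) + (a : ℂ) • 𝓕⁻ φ := by
    have h : ∀ ψ : 𝓢(ℝ, ℂ), 𝓕⁻ ψ = FourierTransform.fourierInvCLM ℂ 𝓢(ℝ, ℂ) ψ := fun _ => rfl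
    simp only [h, shiftDeriv, _root_.add_apply, _root_.smul_apply, map_add, map_smul,
      ContinuousLinearMap.id_apply]
  rw [h2, h1, fourierInv_lineDerivOp_eq, add_apply, smul_apply, smul_apply,
    smulLeftCLM_apply_apply hg, I_mul_shiftedWave]
  simp
  ring

theorem fourierInv_sub_freeOp (a : ℝ) (z : ℂ) (φ : 𝓢(ℝ, ℂ)) (ξ : ℝ) :
    𝓕⁻ (z • φ - freeOp a φ) ξ = kdvDenom z (shiftedWave a ξ) * 𝓕⁻ φ ξ := by
  have h : ∀ ψ : 𝓢(ℝ, ℂ), 𝓕⁻ ψ = FourierTransform.fourierInvCLM ℂ 𝓢(ℝ, ℂ) ψ := fun _ => rfl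
  have h' := fourierInv_shiftDeriv a
  simp only [h] at h' ⊢
  simp only [freeOp, _root_.add_apply, _root_.smul_apply,
    ContinuousLinearMap.comp_apply, map_add, map_sub, map_smul, sub_apply, add_apply, smul_apply,
    h', smul_eq_mul, kdvDenom]
  ring

include ha hz in
-- Divide by the symbol: it is bounded away from 0, so its reciprocal has temperate growth and
-- multiplies Schwartz functions.
theorem exists_sub_freeOp_eq (ψ : 𝓢(ℝ, ℂ)) : ∃ φ : 𝓢(ℝ, ℂ), z • φ - freeOp a φ = ψ := by
  have hg := hasTemperateGrowth_inv_kdvDenom ha hz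
  refine ⟨𝓕 (smulLeftCLM ℂ (fun ξ => (kdvDenom z (shiftedWave a ξ))⁻¹) (𝓕⁻ ψ)), ?_⟩
  have h : ∀ u v : 𝓢(ℝ, ℂ), 𝓕⁻ u = 𝓕⁻ v → u = v := fun u v huv => by
    have hu : 𝓕 (𝓕⁻ u) = u := FourierTransform.fourier_fourierInv_eq u
    have hv : 𝓕 (𝓕⁻ v) = v := FourierTransform.fourier_fourierInv_eq v
    rw [← hu, huv, hv]
  refine h _ _ ?_
  ext ξ
  rw [fourierInv_sub_freeOp, FourierTransform.fourierInv_fourier_eq, smulLeftCLM_apply_apply hg,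
    smul_eq_mul, mul_inv_cancel_left₀ (kdvDenom_ne_zero ha hz ξ)]

end Symbol

/-! ### The weak form of the bundle. -/

theorem fourierMultiplier_apply (a : ℝ) (m : ℂ → ℂ) (f : WeightedL2 a) :
    fourierMultiplier a m f = (weightIso a).symm ((Lp.fourierTransformₗᵢ ℝ ℂ).symm
      (mulL2 volume (fun ξ : ℝ => m (shiftedWave a ξ))
        (Lp.fourierTransformₗᵢ ℝ ℂ (weightIso a f)))) := rfl

theorem schwartzPairing_mulL2 {m : ℝ → ℂ} (hm : MemLp m ∞ volume) {φ χ : 𝓢(ℝ, ℂ)}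
    (h : ∀ ξ, m ξ * φ ξ = χ ξ) (f : Lp ℂ 2 (volume : Measure ℝ)) :
    schwartzPairing φ (mulL2 volume m f) = schwartzPairing χ f := by
  rw [schwartzPairing_apply, schwartzPairing_apply]
  refine integral_congr_ae ?_
  filter_upwards [coeFn_mulL2 hm f] with x hx
  rw [hx, ← h]
  ring

/-- Both Fourier transforms pass to the test function. Asking for `χ` avoids requiring that the
symbol preserve the Schwartz space; it only has to do so on the given `φ`. -/
theorem schwartzPairing_fourierMultiplier {a : ℝ} {m : ℂ → ℂ}
    (hm : MemLp (fun ξ : ℝ => m (shiftedWave a ξ)) ∞ volume) {φ χ : 𝓢(ℝ, ℂ)}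
    (h : ∀ ξ, m (shiftedWave a ξ) * 𝓕⁻ φ ξ = 𝓕⁻ χ ξ) (f : WeightedL2 a) :
    schwartzPairing φ (weightIso a (fourierMultiplier a m f)) =
      schwartzPairing χ (weightIso a f) := by
  have hχ : 𝓕 (𝓕⁻ χ) = χ := FourierTransform.fourier_fourierInv_eq χ
  rw [fourierMultiplier_apply, LinearIsometryEquiv.apply_symm_apply, schwartzPairing_fourierInv,
    schwartzPairing_mulL2 hm h, schwartzPairing_fourier, hχ]

/-- The multiple `3/2 Θ` of the soliton, as a Schwartz function. -/
def potential : 𝓢(ℝ, ℂ) := (3 / 2 : ℂ) • expSolitonMap (a := 0) (by simp)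

theorem potential_apply (x : ℝ) : potential x = ((3 / 2 * soliton x : ℝ) : ℂ) := by
  simp [potential, expSoliton]

theorem memLp_top_schwartz (a : ℝ) (θ : 𝓢(ℝ, ℂ)) : MemLp θ ∞ (expWeight a) := by
  obtain ⟨C, -, hC⟩ := θ.decay 0 0
  refine memLp_top_of_bound θ.continuous.aestronglyMeasurable C (.of_forall fun x => ?_)
  simpa using hC x

theorem weightIso_ae (a : ℝ) (f : WeightedL2 a) :
    weightIso a f =ᵐ[volume] fun x => (Real.exp (a * x) : ℂ) * f x :=
  MemLp.coeFn_toLp ((memLp_expWeight_iff a f).2 (Lp.memLp f))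

theorem weightIso_mulL2 (a : ℝ) (θ : 𝓢(ℝ, ℂ)) (f : WeightedL2 a) :
    weightIso a (mulL2 (expWeight a) θ f) = mulL2 volume θ (weightIso a f) := by
  refine (mulL2_eq (θ.memLp_top volume) ?_).symm
  have h := coeFn_mulL2 (memLp_top_schwartz a θ) f
  rw [Filter.EventuallyEq, ae_expWeight] at h
  filter_upwards [h, weightIso_ae a f, weightIso_ae a (mulL2 (expWeight a) θ f)] with x h1 h2 h3
  rw [h3, h2, h1]
  ring

theorem kdvBundle_apply (a : ℝ) (z : ℂ) (f : WeightedL2 a) :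
    kdvBundle a z f =
      f + fourierMultiplier a (kdvSymbol z) (mulL2 (expWeight a) potential f) := by
  rw [show ⇑potential = _ from funext potential_apply]
  rfl

section Bundle

variable {a : ℝ} (ha : 0 < a) {z : ℂ} (hz : -decayRate a < z.re)

include ha hz in
/-- The weak form of `W₀(z) f = (z - ½ ∂ + ⅙ ∂³)⁻¹ (z f - ½ ∂ f + ⅙ ∂³ f + 3/2 ∂ (Θ f))`. -/
theorem schwartzPairing_kdvBundle (φ : 𝓢(ℝ, ℂ)) (f : WeightedL2 a) :
    schwartzPairing (z • φ - freeOp a φ) (weightIso a (kdvBundle a z f)) =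
      schwartzPairing (z • φ - solitonOp a φ) (weightIso a f) := by
  have hm : ∀ ξ, kdvSymbol z (shiftedWave a ξ) * 𝓕⁻ (z • φ - freeOp a φ) ξ =
      𝓕⁻ (-shiftDeriv a φ) ξ := fun ξ => by
    have h : ∀ ψ : 𝓢(ℝ, ℂ), 𝓕⁻ (-ψ) ξ = -𝓕⁻ ψ ξ := fun ψ => by
      have h : ∀ ψ : 𝓢(ℝ, ℂ), 𝓕⁻ ψ = FourierTransform.fourierInvCLM ℂ 𝓢(ℝ, ℂ) ψ := fun _ => rfl
      rw [h, h, map_neg]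
      rfl
    have := kdvDenom_ne_zero ha hz ξ
    rw [h, fourierInv_shiftDeriv, fourierInv_sub_freeOp, kdvSymbol_eq]
    field_simp
  have hp : ∀ x, potential x * (-shiftDeriv a φ) x =
      (-((3 / 2 : ℂ) • (shiftDeriv a φ - mulKink (mulKink (shiftDeriv a φ))))) x := fun x => by
    rw [potential_apply]
    simp only [neg_apply, smul_apply, sub_apply, mulKink_apply, smul_eq_mul]
    push_cast
    rw [ofReal_soliton]
    ring
  rw [kdvBundle_apply, map_add, map_add,
    schwartzPairing_fourierMultiplier (memLp_top_kdvSymbol ha hz) hm, weightIso_mulL2,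
    schwartzPairing_mulL2 (potential.memLp_top volume) hp, ← _root_.add_apply, ← map_add]
  congr 2
  simp only [solitonOp, _root_.add_apply, _root_.sub_apply, _root_.smul_apply,
    ContinuousLinearMap.comp_apply]
  abel

theorem weightIso_ext {f g : WeightedL2 a}
    (h : ∀ φ : 𝓢(ℝ, ℂ), schwartzPairing φ (weightIso a f) = schwartzPairing φ (weightIso a g)) :
    f = g := by
  apply (weightIso a).injective
  rw [← sub_eq_zero]
  exact eq_zero_of_schwartzPairing_eq_zero fun φ _ => by rw [map_sub, h, sub_self]

include ha hz in
-- Since z - `freeOp` is onto, testing against its range is testing against all Schwartz functions.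
theorem kdvBundle_eq_iff (f g : WeightedL2 a) : kdvBundle a z f = g ↔
    ∀ φ : 𝓢(ℝ, ℂ), schwartzPairing (z • φ - freeOp a φ) (weightIso a g) =
      schwartzPairing (z • φ - solitonOp a φ) (weightIso a f) := by
  refine ⟨fun h φ => by rw [← h, schwartzPairing_kdvBundle ha hz], fun h => ?_⟩
  refine weightIso_ext fun ψ => ?_
  obtain ⟨φ, rfl⟩ := exists_sub_freeOp_eq ha hz ψ
  rw [h, schwartzPairing_kdvBundle ha hz]

end Bundle

/-! ### Compactness -/

/-- An operator into `L²` that is given by a square integrable family of functionals is compact. -/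
theorem isCompactOperator_of_kernel {X : Type*} [NormedAddCommGroup X] [NormedSpace ℂ X]
    (k : Lp (X →L[ℂ] ℂ) 2 (volume : Measure ℝ)) (T : X →L[ℂ] Lp ℂ 2 (volume : Measure ℝ))
    (h : ∀ f, T f =ᵐ[volume] fun ξ => k ξ f) : IsCompactOperator T := by
  let Φ : Lp (X →L[ℂ] ℂ) 2 (volume : Measure ℝ) →L[ℂ] X →L[ℂ] Lp ℂ 2 (volume : Measure ℝ) :=
    (ContinuousLinearMap.compLpL₂ 2 volume (ContinuousLinearMap.apply ℂ ℂ (E := X))).flip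
  have hΦ : ∀ k f, Φ k f =ᵐ[volume] fun ξ => k ξ f := fun k f =>
    ContinuousLinearMap.coeFn_compLp' (ContinuousLinearMap.apply ℂ ℂ f) k
  have hT : T = Φ k := by
    refine ContinuousLinearMap.ext fun f => Lp.ext ?_
    filter_upwards [h f, hΦ k f] with ξ h1 h2
    rw [h1, h2]
  rw [hT]
  -- Compact operators are closed under sums and norm limits, so an indicator kernel suffices, and
  -- that gives an operator of rank at most one.
  refine Lp.induction (p := 2) (by norm_num) (motive := fun k => IsCompactOperator (Φ k))
    ?_ ?_ ?_ k
  · intro c s hs hμs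
    have hr : Φ (Lp.simpleFunc.indicatorConst 2 hs hμs.ne c : Lp (X →L[ℂ] ℂ) 2 volume) =
        c.smulRight (indicatorConstLp 2 hs hμs.ne (1 : ℂ)) := by
      refine ContinuousLinearMap.ext fun f => Lp.ext ?_
      have h3 : (Lp.simpleFunc.indicatorConst 2 hs hμs.ne c : Lp (X →L[ℂ] ℂ) 2 volume) =ᵐ[volume]
          s.indicator fun _ => c := by
        rw [Lp.simpleFunc.coe_indicatorConst]
        exact indicatorConstLp_coeFn
      filter_upwards [hΦ _ f, h3,
        Lp.coeFn_smul (c f) (indicatorConstLp 2 hs hμs.ne (1 : ℂ)),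
        indicatorConstLp_coeFn (p := 2) (hs := hs) (hμs := hμs.ne) (c := (1 : ℂ))] with ξ h1 h2 h4 h5
      rw [h1, h2, ContinuousLinearMap.smulRight_apply, h4, Pi.smul_apply, h5]
      by_cases hξ : ξ ∈ s <;> simp [hξ]
    rw [hr]
    exact (isCompactOperator_of_locallyCompactSpace_rng (ContinuousLinearMap.toSpanSingleton ℂ
      (indicatorConstLp (μ := (volume : Measure ℝ)) 2 hs hμs.ne (1 : ℂ)))).comp_clm c
  · intro f g hf hg _ h1 h2
    rw [map_add]
    exact h1.add h2
  · exact isClosed_setOfPred_isCompactOperator.preimage Φ.continuous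

/-- The functional `f ↦ ∫ e^{-2πixξ} θ(x) f(x) dx`. -/
def fourierFunctional (θ : 𝓢(ℝ, ℂ)) (ξ : ℝ) : Lp ℂ 2 (volume : Measure ℝ) →L[ℂ] ℂ :=
  (ContinuousLinearMap.mul ℂ ℂ).lpPairing volume 2 2
    (mulL2 volume (fun x => Complex.exp (((-2 * Real.pi * (x * ξ) : ℝ) : ℂ) * Complex.I))
      (θ.toLp 2 volume))

theorem memLp_top_exp_mul_I (ξ : ℝ) :
    MemLp (fun x : ℝ => Complex.exp (((-2 * Real.pi * (x * ξ) : ℝ) : ℂ) * Complex.I)) ∞ volume :=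
  memLp_top_of_bound (by fun_prop) 1
    (.of_forall fun x => by rw [Complex.norm_exp_ofReal_mul_I])

theorem norm_fourierFunctional_le (θ : 𝓢(ℝ, ℂ)) (ξ : ℝ) :
    ‖fourierFunctional θ ξ‖ ≤
      ‖(ContinuousLinearMap.mul ℂ ℂ).lpPairing (volume : Measure ℝ) 2 2‖ * ‖θ.toLp 2 volume‖ := by
  refine (ContinuousLinearMap.le_opNorm _ _).trans ?_
  gcongr
  refine (ContinuousLinearMap.le_of_opNorm_le _ (norm_mulL2_le (C := 1) (by fun_prop)
    fun x => by rw [Complex.norm_exp_ofReal_mul_I]) _).trans (by rw [one_mul])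

/-- Needed for measurability of the kernel. The Lipschitz constant comes from |e^{is} - 1| ≤ |s|,
which costs one factor x, absorbed by the decay of θ. -/
theorem continuous_fourierFunctional (θ : 𝓢(ℝ, ℂ)) : Continuous (fourierFunctional θ) := by
  refine (ContinuousLinearMap.continuous _).comp ?_
  refine (LipschitzWith.of_dist_le_mul
    (K := Real.toNNReal (2 * Real.pi * ‖(mulVar θ).toLp 2 volume‖)) fun ξ η => ?_).continuous
  rw [Real.coe_toNNReal _ (by positivity), dist_eq_norm, dist_eq_norm]
  rw [show 2 * Real.pi * ‖(mulVar θ).toLp 2 volume‖ * ‖ξ - η‖ =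
    (2 * Real.pi * ‖ξ - η‖) * ‖(mulVar θ).toLp 2 volume‖ by ring]
  refine Lp.norm_le_mul_norm_of_ae_le_mul ?_
  filter_upwards [Lp.coeFn_sub (mulL2 volume (fun x : ℝ => Complex.exp (((-2 * Real.pi * (x * ξ) :
      ℝ) : ℂ) * Complex.I)) (θ.toLp 2 volume)) (mulL2 volume (fun x : ℝ => Complex.exp
        (((-2 * Real.pi * (x * η) : ℝ) : ℂ) * Complex.I)) (θ.toLp 2 volume)),
    coeFn_mulL2 (memLp_top_exp_mul_I ξ) (θ.toLp 2 volume),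
    coeFn_mulL2 (memLp_top_exp_mul_I η) (θ.toLp 2 volume),
    (mulVar θ).coeFn_toLp 2 volume, θ.coeFn_toLp 2 volume] with x h1 h2 h3 h4 h5
  rw [h1, Pi.sub_apply, h2, h3, h4, h5, mulVar_apply, ← sub_mul, norm_mul, norm_mul,
    ← mul_assoc (2 * Real.pi * ‖ξ - η‖)]
  gcongr
  have h : Complex.exp (((-2 * Real.pi * (x * ξ) : ℝ) : ℂ) * Complex.I) -
      Complex.exp (((-2 * Real.pi * (x * η) : ℝ) : ℂ) * Complex.I) =
      Complex.exp (((-2 * Real.pi * (x * η) : ℝ) : ℂ) * Complex.I) *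
        (Complex.exp (Complex.I * ((-2 * Real.pi * (x * (ξ - η)) : ℝ) : ℂ)) - 1) := by
    rw [mul_sub, ← Complex.exp_add, mul_one]
    congr 2
    push_cast
    ring
  rw [h, norm_mul, Complex.norm_exp_ofReal_mul_I, one_mul]
  refine (Real.norm_exp_I_mul_ofReal_sub_one_le).trans (le_of_eq ?_)
  rw [norm_mul, norm_mul, norm_mul, norm_neg, Complex.norm_real,
    Real.norm_of_nonneg Real.pi_pos.le]
  simp
  ring

theorem fourierFunctional_apply (θ φ : 𝓢(ℝ, ℂ)) (ξ : ℝ) :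
    fourierFunctional θ ξ (φ.toLp 2 volume) = 𝓕 (smulLeftCLM ℂ θ φ) ξ := by
  rw [fourierFunctional, ContinuousLinearMap.lpPairing_eq_integral, fourier_coe,
    Real.fourier_eq']
  refine integral_congr_ae ?_
  filter_upwards [coeFn_mulL2 (memLp_top_exp_mul_I ξ) (θ.toLp 2 volume),
    θ.coeFn_toLp 2 volume, φ.coeFn_toLp 2 volume] with x h1 h2 h3
  rw [ContinuousLinearMap.mul_apply', h1, h2, h3, smulLeftCLM_apply_apply θ.hasTemperateGrowth]
  simp [mul_assoc, mul_comm x ξ]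

/-- The operator `f ↦ m · 𝓕 (θ f)` is compact on `L²` if `m` is bounded and square integrable. -/
theorem isCompactOperator_mul_fourier_mul {m : ℝ → ℂ} (hm : MemLp m ∞ volume)
    (hm2 : MemLp m 2 volume) (θ : 𝓢(ℝ, ℂ)) :
    IsCompactOperator (mulL2 volume m ∘L
      ((Lp.fourierTransformₗᵢ ℝ ℂ) :
        Lp ℂ 2 (volume : Measure ℝ) →L[ℂ] Lp ℂ 2 (volume : Measure ℝ)) ∘L mulL2 volume θ) := by
  set T := mulL2 volume m ∘L ((Lp.fourierTransformₗᵢ ℝ ℂ) :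
        Lp ℂ 2 (volume : Measure ℝ) →L[ℂ] Lp ℂ 2 (volume : Measure ℝ)) ∘L mulL2 volume θ with hT
  have hk : MemLp (fun ξ => m ξ • fourierFunctional θ ξ) 2 volume :=
    hm2.of_le_mul (hm2.1.smul (continuous_fourierFunctional θ).aestronglyMeasurable)
      (.of_forall fun ξ => by
        rw [norm_smul, mul_comm]
        gcongr
        exact norm_fourierFunctional_le θ ξ)
  let B : Lp ℂ 2 (volume : Measure ℝ) →L[ℂ] Lp ℂ 2 (volume : Measure ℝ) :=
    (ContinuousLinearMap.compLpL₂ 2 volume (ContinuousLinearMap.apply ℂ ℂ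
      (E := Lp ℂ 2 (volume : Measure ℝ)))).flip (hk.toLp _)
  have hB : ∀ f, B f =ᵐ[volume] fun ξ => hk.toLp _ ξ f := fun f =>
    ContinuousLinearMap.coeFn_compLp' (ContinuousLinearMap.apply ℂ ℂ f) (hk.toLp _)
  have hTB : T = B := by
    refine DFunLike.coe_injective ?_
    -- On the dense set of Schwartz functions the Fourier transform is given by its integral, so the
    -- two operators can be compared pointwise.
    refine (denseRange_toLpCLM (F := ℂ) (p := 2) (μ := (volume : Measure ℝ)) (E := ℝ)
      (by norm_num)).equalizer T.continuous B.continuous ?_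
    ext1 φ
    refine Lp.ext ?_
    have h1 : mulL2 volume θ (φ.toLp 2 volume) = (smulLeftCLM ℂ θ φ).toLp 2 volume := by
      refine mulL2_eq (θ.memLp_top volume) ?_
      filter_upwards [φ.coeFn_toLp 2 volume, (smulLeftCLM ℂ θ φ).coeFn_toLp 2 volume] with x h2 h3
      rw [h2, h3, smulLeftCLM_apply_apply θ.hasTemperateGrowth, smul_eq_mul]
    have h2 : T (φ.toLp 2 volume) = mulL2 volume m ((𝓕 (smulLeftCLM ℂ θ φ)).toLp 2 volume) := by
      rw [← SchwartzMap.toLp_fourier_eq, ← h1]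
      rfl
    simp only [Function.comp_apply, toLpCLM_apply]
    rw [h2]
    filter_upwards [coeFn_mulL2 hm ((𝓕 (smulLeftCLM ℂ θ φ)).toLp 2 volume), hB (φ.toLp 2 volume),
      hk.coeFn_toLp, (𝓕 (smulLeftCLM ℂ θ φ)).coeFn_toLp 2 volume] with ξ h3 h4 h5 h6
    rw [h3, h4, h5, h6, _root_.smul_apply, fourierFunctional_apply, smul_eq_mul]
  exact isCompactOperator_of_kernel (hk.toLp _) T fun f => hTB ▸ hB f

theorem isCompactOperator_kdvBundle_sub_id {a : ℝ} (ha : 0 < a) {z : ℂ} (hz : -decayRate a < z.re) :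
    IsCompactOperator (ContinuousLinearMap.id ℂ (WeightedL2 a) - kdvBundle a z) := by
  have h1 := isCompactOperator_mul_fourier_mul (memLp_top_kdvSymbol ha hz)
    (memLp_two_kdvSymbol ha hz) potential
  have h2 := (h1.comp_clm (weightIso a : WeightedL2 a →L[ℂ] Lp ℂ 2 (volume : Measure ℝ))).clm_comp
    (-(((weightIso a).symm : Lp ℂ 2 (volume : Measure ℝ) →L[ℂ] WeightedL2 a) ∘L
      ((Lp.fourierTransformₗᵢ ℝ ℂ).symm :
        Lp ℂ 2 (volume : Measure ℝ) →L[ℂ] Lp ℂ 2 (volume : Measure ℝ))))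
  convert! h2 using 1
  ext1 f
  rw [_root_.sub_apply, kdvBundle_apply, ContinuousLinearMap.id_apply, fourierMultiplier_apply,
    weightIso_mulL2]
  simp

/-! ### Analyticity -/

theorem isOpen_lt_re (b : ℝ) : IsOpen {z : ℂ | b < z.re} :=
  isOpen_lt continuous_const Complex.continuous_re

/-- The resolvent identity r_z - r_w = -(z - w) r_w r_z, used twice, gives the remainder (z - w)² n
r_w² r_z. Only n·r has to be bounded, so that n = 1 (the resolvent) and the unbounded n = i(k + ia)
(the bundle) are both covered. -/
theorem differentiableAt_mulL2_mul_inv_kdvDenom {a : ℝ} (ha : 0 < a) {n : ℝ → ℂ} (hn : Continuous n)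
    (hb : ∀ z : ℂ, -decayRate a < z.re →
      ∃ C : ℝ, ∀ ξ, ‖n ξ * (kdvDenom z (shiftedWave a ξ))⁻¹‖ ≤ C)
    {w : ℂ} (hw : -decayRate a < w.re) :
    DifferentiableAt ℂ
      (fun z => mulL2 volume fun ξ => n ξ * (kdvDenom z (shiftedWave a ξ))⁻¹) w := by
  set r : ℂ → ℝ → ℂ := fun z ξ => (kdvDenom z (shiftedWave a ξ))⁻¹ with hr
  -- Half the distance from `w` to the edge of the half-plane, which bounds r_z by δ⁻¹ uniformly
  -- near `w`.
  set δ := (w.re + decayRate a) / 2 with hδ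
  have hδ0 : 0 < δ := by rw [hδ]; linarith
  obtain ⟨C, hC⟩ := hb w hw
  have hC0 : 0 ≤ C := (norm_nonneg _).trans (hC 0)
  have hcont : ∀ z : ℂ, -decayRate a < z.re → Continuous (r z) := fun z hz =>
    continuous_inv_kdvDenom ha hz
  have hsub : ∀ z : ℂ, -decayRate a < z.re → ∀ ξ, r z ξ - r w ξ = (z - w) * (-(r w ξ * r z ξ)) :=
    fun z hz ξ => by
      have h1 := kdvDenom_ne_zero ha hz ξ
      have h2 := kdvDenom_ne_zero ha hw ξ
      have h3 : kdvDenom z (shiftedWave a ξ) - kdvDenom w (shiftedWave a ξ) = z - w := by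
        simp only [kdvDenom]; ring
      simp only [hr]
      rw [← h3]
      field_simp
      ring
  have hmem : ∀ m : ℝ → ℂ, Continuous m → (∃ D : ℝ, ∀ ξ, ‖m ξ‖ ≤ D) → MemLp m ∞ volume :=
    fun m hm ⟨D, hD⟩ => memLp_top_of_bound hm.aestronglyMeasurable D (.of_forall hD)
  have hbr : ∀ z : ℂ, -decayRate a < z.re → ∀ ξ, ‖r z ξ‖ ≤ (z.re + decayRate a)⁻¹ := fun z hz =>
    norm_inv_kdvDenom_le ha hz
  have hb1 : ∀ z : ℂ, -decayRate a < z.re → ∀ ξ, ‖-(n ξ * r w ξ * r z ξ)‖ ≤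
      C * (z.re + decayRate a)⁻¹ := fun z hz ξ => by
    rw [norm_neg, norm_mul]
    exact mul_le_mul (hC ξ) (hbr z hz ξ) (norm_nonneg _) hC0
  have hb2 : ∀ z : ℂ, -decayRate a < z.re → ∀ ξ, ‖n ξ * r w ξ * r w ξ * r z ξ‖ ≤
      C * (w.re + decayRate a)⁻¹ * (z.re + decayRate a)⁻¹ := fun z hz ξ => by
    rw [norm_mul, norm_mul _ (r w ξ)]
    have h1 := hC ξ
    have h2 := hbr z hz ξ
    have h3 := hbr w hw ξ
    have h4 : 0 ≤ C * (w.re + decayRate a)⁻¹ := mul_nonneg hC0 ((norm_nonneg _).trans h3)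
    gcongr
  have hkey : ∀ z : ℂ, -decayRate a < z.re →
      (mulL2 volume fun ξ => n ξ * r z ξ) - (mulL2 volume fun ξ => n ξ * r w ξ) -
        (z - w) • (mulL2 volume fun ξ => -(n ξ * r w ξ * r w ξ)) =
      ((z - w) * (z - w)) • mulL2 volume fun ξ => n ξ * r w ξ * r w ξ * r z ξ := fun z hz => by
    have cz := hcont z hz
    have cw := hcont w hw
    rw [mulL2_sub_eq_smul (m := fun ξ => n ξ * r z ξ) (n := fun ξ => n ξ * r w ξ)
      (hmem _ (hn.mul cz) (hb z hz)) (hmem _ (hn.mul cw) (hb w hw))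
      (r := fun ξ => -(n ξ * r w ξ * r z ξ)) (hmem _ (by fun_prop) ⟨_, hb1 z hz⟩) (z - w)
      (fun ξ => by rw [← mul_sub, hsub z hz]; ring), ← smul_sub,
      mulL2_sub_eq_smul (hmem _ (by fun_prop) ⟨_, hb1 z hz⟩) (hmem _ (by fun_prop) ⟨_, hb1 w hw⟩)
      (r := fun ξ => n ξ * r w ξ * r w ξ * r z ξ) (hmem _ (by fun_prop) ⟨_, hb2 z hz⟩) (z - w)
      (fun ξ => by linear_combination (-(n ξ * r w ξ)) * hsub z hz ξ), smul_smul]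
  refine HasDerivAt.differentiableAt
    (f' := mulL2 volume fun ξ => -(n ξ * r w ξ * r w ξ)) ?_
  rw [hasDerivAt_iff_isLittleO]
  refine Asymptotics.IsBigO.trans_isLittleO (g := fun z => ‖z - w‖ ^ 2) ?_
    (Asymptotics.isLittleO_pow_sub_sub w one_lt_two)
  refine Asymptotics.IsBigO.of_bound (C * (w.re + decayRate a)⁻¹ * δ⁻¹) ?_
  have hev : ∀ᶠ z in 𝓝 w, -decayRate a + δ < z.re :=
    (isOpen_lt_re (-decayRate a + δ)).mem_nhds (by simp only [Set.mem_ofPred_eq]; linarith)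
  filter_upwards [hev] with z hz
  have hz' : -decayRate a < z.re := by linarith
  have hwp : 0 < w.re + decayRate a := by linarith
  rw [hkey z hz', norm_smul, ← sq, mul_comm, norm_pow, norm_pow, norm_norm]
  gcongr
  refine (norm_mulL2_le ?_ (hb2 z hz')).trans ?_
  · have cz := hcont z hz'
    have cw := hcont w hw
    exact (by fun_prop : Continuous fun ξ => n ξ * r w ξ * r w ξ * r z ξ).aestronglyMeasurable
  · gcongr
    linarith

/-- The operator `(z - ½ ∂ + ⅙ ∂³)⁻¹` on `L²_a`. -/
def kdvResolvent (a : ℝ) (z : ℂ) : WeightedL2 a →L[ℂ] WeightedL2 a :=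
  fourierMultiplier a fun k => (kdvDenom z k)⁻¹

theorem differentiableAt_fourierMultiplier {a : ℝ} {m : ℂ → ℂ → ℂ} {w : ℂ}
    (h : DifferentiableAt ℂ (fun z => mulL2 volume fun ξ => m z (shiftedWave a ξ)) w) :
    DifferentiableAt ℂ (fun z => fourierMultiplier a (m z)) w :=
  (differentiableAt_const _).clm_comp ((differentiableAt_const _).clm_comp
    (h.clm_comp (differentiableAt_const _)))

section

variable {a : ℝ} (ha : 0 < a)

include ha in
theorem analyticOnNhd_kdvResolvent :
    AnalyticOnNhd ℂ (kdvResolvent a) {z : ℂ | -decayRate a < z.re} := by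
  refine DifferentiableOn.analyticOnNhd (fun w hw => ?_) (isOpen_lt_re _)
  refine (differentiableAt_fourierMultiplier ?_).differentiableWithinAt
  have h := differentiableAt_mulL2_mul_inv_kdvDenom ha (n := fun _ => 1) continuous_const
    (fun z hz => ⟨(z.re + decayRate a)⁻¹, fun ξ => by
      rw [one_mul]; exact norm_inv_kdvDenom_le ha hz ξ⟩) hw
  simpa only [one_mul] using h

include ha in
theorem analyticOnNhd_kdvBundle :
    AnalyticOnNhd ℂ (kdvBundle a) {z : ℂ | -decayRate a < z.re} := by
  refine DifferentiableOn.analyticOnNhd (fun w hw => ?_) (isOpen_lt_re _)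
  refine DifferentiableAt.differentiableWithinAt ?_
  refine (differentiableAt_const _).add
    ((differentiableAt_fourierMultiplier ?_).clm_comp (differentiableAt_const _))
  have hc := continuous_shiftedWave (a := a)
  exact differentiableAt_mulL2_mul_inv_kdvDenom ha
    (n := fun ξ => Complex.I * shiftedWave a ξ) (by fun_prop)
    (fun z hz => exists_norm_kdvSymbol_le ha hz) hw

include ha in
theorem schwartzPairing_kdvResolvent {z : ℂ} (hz : -decayRate a < z.re) (φ : 𝓢(ℝ, ℂ))
    (f : WeightedL2 a) :
    schwartzPairing (z • φ - freeOp a φ) (weightIso a (kdvResolvent a z f)) =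
      schwartzPairing φ (weightIso a f) :=
  schwartzPairing_fourierMultiplier (memLp_top_inv_kdvDenom ha hz) (fun ξ => by
    rw [fourierInv_sub_freeOp, inv_mul_cancel_left₀ (kdvDenom_ne_zero ha hz ξ)]) f

end

/-! ### Operators that become bijective after a perturbation of rank one -/

section RankOne

variable {X : Type*} [NormedAddCommGroup X] [NormedSpace ℂ X] [CompleteSpace X]

/-- The Fredholm alternative for the compact operator I - W at the value 1. -/
theorem bijective_of_isCompactOperator_id_sub {W : X →L[ℂ] X}
    (hc : IsCompactOperator (ContinuousLinearMap.id ℂ X - W)) (hW : ∀ x, W x = 0 → x = 0) :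
    Function.Bijective W := by
  rcases hc.hasEigenvalue_or_mem_resolventSet one_ne_zero with h | h
  · obtain ⟨x, hx⟩ := h.exists_hasEigenvector
    have h1 := hx.apply_eq_smul
    refine absurd (hW x ?_) hx.2
    simpa using h1
  · rw [spectrum.mem_resolventSet_iff, ContinuousLinearMap.isUnit_iff_bijective] at h
    convert! h using 1
    ext x
    simp

/-- The inverse of W + P inverts W modulo operators of finite rank. -/
theorem isFredholm_of_bijective_add {W P : X →L[ℂ] X} (hP : P.toLinearMap.HasFiniteRange)
    (h : Function.Bijective (W + P)) : W.IsFredholm := by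
  let B : X ≃L[ℂ] X := ContinuousLinearEquiv.ofBijective (W + P)
    (LinearMap.ker_eq_bot.2 h.1) (LinearMap.range_eq_top.2 h.2)
  have hB : ∀ x, B x = W x + P x := fun x => rfl
  refine ContinuousLinearMap.IsFredholm.of_isQuasiInverse (v := (B.symm : X →L[ℂ] X)) ⟨?_, ?_⟩
  · refine LinearMap.FiniteRangeSetoid.equiv_iff_hasFiniteRange.2 ?_
    have : (B.symm : X →L[ℂ] X).toLinearMap ∘ₗ W.toLinearMap - LinearMap.id =
        -((B.symm : X →L[ℂ] X).toLinearMap ∘ₗ P.toLinearMap) := by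
      ext x
      have : B.symm (W x + P x) = x := by rw [← hB, B.symm_apply_apply]
      rw [map_add] at this
      change B.symm (W x) - x = -B.symm (P x)
      rw [sub_eq_iff_eq_add, neg_add_eq_sub]
      exact eq_sub_of_add_eq this
    rw [this]
    exact (hP.comp_left _).neg
  · refine LinearMap.FiniteRangeSetoid.equiv_iff_hasFiniteRange.2 ?_
    have : W.toLinearMap ∘ₗ (B.symm : X →L[ℂ] X).toLinearMap - LinearMap.id =
        -(P.toLinearMap ∘ₗ (B.symm : X →L[ℂ] X).toLinearMap) := by
      ext x
      have : W (B.symm x) + P (B.symm x) = x := by rw [← hB, B.apply_symm_apply]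
      change W (B.symm x) - x = -P (B.symm x)
      rw [sub_eq_iff_eq_add, neg_add_eq_sub]
      exact eq_sub_of_add_eq this
    rw [this]
    exact (hP.comp_right _).neg

/-- A compact perturbation of the identity whose kernel is spanned by `e` is Fredholm of index
zero. -/
theorem isFredholm_of_ker_eq_span {W : X →L[ℂ] X}
    (hc : IsCompactOperator (ContinuousLinearMap.id ℂ X - W)) {e u : X} (he : e ≠ 0)
    (hker : ∀ x, W x = 0 ↔ ∃ c : ℂ, x = c • e) (hu : ∀ x, W x ≠ u) :
    W.IsFredholm ∧ Module.finrank ℂ W.ker = Module.finrank ℂ (X ⧸ W.range) := by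
  obtain ⟨ℓ, hℓ⟩ := SeparatingDual.exists_eq_one (R := ℂ) he
  -- P sends `e` to `u`, outside the range of W, which repairs injectivity; compactness then gives
  -- bijectivity.
  let P : X →L[ℂ] X := ℓ.smulRight u
  have hP : P.toLinearMap.HasFiniteRange := by
    have : P.toLinearMap = (LinearMap.toSpanSingleton ℂ X u) ∘ₗ ℓ.toLinearMap := by
      ext x; simp [P]
    rw [this]
    exact LinearMap.HasFiniteRange.comp_left LinearMap.HasFiniteRange.of_isNoetherian_rng _
  have hPc : IsCompactOperator P :=
    (isCompactOperator_of_locallyCompactSpace_rng (ContinuousLinearMap.toSpanSingleton ℂ u)).comp_clm ℓ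
  have hu' : ∀ (x : X) (c : ℂ), W x + c • u = 0 → c = 0 := fun x c h => by
    by_contra hc0
    refine hu (-c⁻¹ • x) ?_
    rw [map_smul, eq_neg_of_add_eq_zero_left h, smul_neg, neg_smul, neg_neg, inv_smul_smul₀ hc0]
  have hinj : ∀ x, (W + P) x = 0 → x = 0 := fun x hx => by
    have h1 : ℓ x = 0 := hu' x (ℓ x) hx
    have h2 : W x = 0 := by simpa [P, h1] using hx
    obtain ⟨c, rfl⟩ := (hker x).1 h2
    have : c = 0 := by simpa [hℓ] using h1
    rw [this, zero_smul]
  have hbij : Function.Bijective (W + P) := by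
    refine bijective_of_isCompactOperator_id_sub ?_ hinj
    convert! hc.sub hPc using 1
    ext x
    simp only [_root_.sub_apply, _root_.add_apply, Pi.sub_apply]
    abel
  refine ⟨isFredholm_of_bijective_add hP hbij, ?_⟩
  have h1 : W.ker = Submodule.span ℂ {e} := by
    ext x
    rw [Submodule.mem_span_singleton]
    exact (hker x).trans ⟨fun ⟨c, h⟩ => ⟨c, h.symm⟩, fun ⟨c, h⟩ => ⟨c, h.symm⟩⟩
  rw [h1, finrank_span_singleton he]
  symm
  refine finrank_eq_one (Submodule.Quotient.mk u) ?_ fun y => ?_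
  · intro h
    obtain ⟨x, hx⟩ := (Submodule.Quotient.mk_eq_zero _).1 h
    exact hu x hx
  -- Solving W x + ℓ(x)u = y shows that the class of `u` spans the cokernel.
  · obtain ⟨y, rfl⟩ := Submodule.Quotient.mk_surjective _ y
    obtain ⟨x, hx⟩ := hbij.2 y
    refine ⟨ℓ x, ?_⟩
    rw [← Submodule.Quotient.mk_smul, Submodule.Quotient.eq]
    refine ⟨-x, ?_⟩
    have hx' : W x + ℓ x • u = y := hx
    rw [← hx']
    simp

end RankOne

/-! ### The kernel of the bundle and its Jordan chains -/

section Chain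

variable {a : ℝ} (ha : 0 < a) (ha' : |a| < √3)

include ha ha' in
theorem neg_decayRate_neg : -decayRate a < 0 := by
  have h3 : a ^ 2 < 3 := by
    have h := pow_lt_pow_left₀ ha' (abs_nonneg a) two_ne_zero
    rwa [sq_abs, Real.sq_sqrt (by norm_num)] at h
  have : 0 < decayRate a := mul_pos (by positivity) (by linarith)
  linarith

include ha in
-- Write the test function as (z - A)ψ: then B(z - A)ψ = (z - L)Bψ, whose pairing with `f` is ⟨Bψ,
-- g⟩ = 0. The source term `g` allows iteration along a Jordan chain.
theorem schwartzPairing_darbouxOp_eq_zero {z : ℂ} (hz : -decayRate a < z.re)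
    {f g : Lp ℂ 2 (volume : Measure ℝ)} (hg : ∀ φ, schwartzPairing (darbouxOp a φ) g = 0)
    (h : ∀ φ, schwartzPairing (z • φ - solitonOp a φ) f = schwartzPairing φ g) (φ : 𝓢(ℝ, ℂ)) :
    schwartzPairing (darbouxOp a φ) f = 0 := by
  obtain ⟨ψ, rfl⟩ := exists_sub_freeOp_eq ha hz φ
  rw [map_sub (darbouxOp _), map_smul (darbouxOp _), ← solitonOp_darbouxOp, h, hg]

include ha ha' in
/-- The generalized kernel of the transpose of `solitonOp` has no Jordan chain of length three. -/
theorem eq_zero_of_chain {f₀ f₁ f₂ : Lp ℂ 2 (volume : Measure ℝ)}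
    (h₀ : ∀ φ, schwartzPairing (solitonOp a φ) f₀ = 0)
    (h₁ : ∀ φ, schwartzPairing (solitonOp a φ) f₁ = schwartzPairing φ f₀)
    (h₂ : ∀ φ, schwartzPairing (solitonOp a φ) f₂ = schwartzPairing φ f₁) : f₀ = 0 := by
  have hz : -decayRate a < (0 : ℂ).re := neg_decayRate_neg ha ha'
  -- The preceding lemma at z = 0, where z - L = -L accounts for the sign of `g`.
  have step : ∀ {f g : Lp ℂ 2 (volume : Measure ℝ)},
      (∀ φ, schwartzPairing (darbouxOp a φ) g = 0) →
      (∀ φ, schwartzPairing (solitonOp a φ) f = schwartzPairing φ g) →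
      ∀ φ, schwartzPairing (darbouxOp a φ) f = 0 := fun {f g} hg h =>
    schwartzPairing_darbouxOp_eq_zero ha hz (g := -g) (fun φ => by rw [map_neg, hg, neg_zero])
      (fun φ => by rw [zero_smul, zero_sub, map_neg, neg_apply, h, map_neg])
  have k₀ := step (f := f₀) (g := 0) (fun φ => map_zero _) (fun φ => by rw [h₀, map_zero])
  have k₂ := step (step k₀ h₁) h₂
  refine eq_zero_of_schwartzPairing_eq_zero fun φ _ => ?_
  rw [← h₁, ← h₂, schwartzPairing_solitonOp_solitonOp ha' k₂]

/-- A multiple of the derivative of the soliton profile, spanning the kernel of `kdvBundle a 0`. -/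
def solitonEigenvector : WeightedL2 a :=
  (weightIso a).symm ((solitonDeriv ha').toLp 2 volume)

/-- A multiple of the derivative of the soliton profile in the wave speed. -/
def solitonAssociatedVector : WeightedL2 a :=
  (weightIso a).symm ((solitonSpeedDeriv ha').toLp 2 volume)

theorem weightIso_solitonEigenvector :
    weightIso a (solitonEigenvector ha') = (solitonDeriv ha').toLp 2 volume :=
  (weightIso a).apply_symm_apply _

theorem weightIso_solitonAssociatedVector :
    weightIso a (solitonAssociatedVector ha') = (solitonSpeedDeriv ha').toLp 2 volume :=
  (weightIso a).apply_symm_apply _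

theorem solitonEigenvector_ne_zero : solitonEigenvector ha' ≠ 0 := by
  intro h
  apply solitonDeriv_ne_zero ha'
  rw [← weightIso_solitonEigenvector, h, map_zero]

theorem neg_ofReal_sqrt_three_div_two_ne_zero : -(((√3 : ℝ) : ℂ) / 2) ≠ 0 := by
  simp

include ha in
theorem schwartzPairing_of_kdvBundle_eq_zero {z : ℂ} (hz : -decayRate a < z.re) {f : WeightedL2 a}
    (hf : kdvBundle a z f = 0) (φ : 𝓢(ℝ, ℂ)) :
    schwartzPairing (solitonOp a φ) (weightIso a f) = z * schwartzPairing φ (weightIso a f) := by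
  have h := (kdvBundle_eq_iff ha hz f 0).1 hf φ
  rw [map_zero, map_zero, map_sub schwartzPairing, map_smul schwartzPairing] at h
  exact (sub_eq_zero.1 h.symm).symm

include ha in
theorem schwartzPairing_darbouxOp_of_kdvBundle_eq_zero {z : ℂ} (hz : -decayRate a < z.re)
    {f : WeightedL2 a} (hf : kdvBundle a z f = 0) (φ : 𝓢(ℝ, ℂ)) :
    schwartzPairing (darbouxOp a φ) (weightIso a f) = 0 :=
  schwartzPairing_darbouxOp_eq_zero ha hz (g := 0) (fun _ => map_zero _) (fun φ => by
    rw [← (kdvBundle_eq_iff ha hz f 0).1 hf, map_zero, map_zero, map_zero]) φ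

include ha ha' in
-- On the annihilator of the range of B the square of Lᵀ vanishes, while Lᵀf = zf; hence z²f = 0.
theorem eq_zero_of_kdvBundle_eq_zero {z : ℂ} (hz : -decayRate a < z.re) (hz0 : z ≠ 0)
    {f : WeightedL2 a} (hf : kdvBundle a z f = 0) : f = 0 := by
  refine weightIso_ext fun φ => ?_
  have h := schwartzPairing_solitonOp_solitonOp ha'
    (schwartzPairing_darbouxOp_of_kdvBundle_eq_zero ha hz hf) φ
  rw [schwartzPairing_of_kdvBundle_eq_zero ha hz hf,
    schwartzPairing_of_kdvBundle_eq_zero ha hz hf] at h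
  rw [map_zero, map_zero]
  simpa [hz0] using h

include ha in
-- A kernel vector lies in the Jordan plane, and applying Lᵀ kills its component along the speed
-- derivative.
theorem kdvBundle_zero_eq_zero_iff (f : WeightedL2 a) :
    kdvBundle a 0 f = 0 ↔ ∃ c : ℂ, f = c • solitonEigenvector ha' := by
  have hz : -decayRate a < (0 : ℂ).re := neg_decayRate_neg ha ha'
  constructor
  · intro hf
    obtain ⟨c, d, h⟩ := exists_eq_add_of_darbouxOp ha'
      (schwartzPairing_darbouxOp_of_kdvBundle_eq_zero ha hz hf)
    have hd : d • (solitonDeriv ha').toLp 2 volume = 0 := by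
      refine eq_zero_of_schwartzPairing_eq_zero fun φ _ => ?_
      have h1 := schwartzPairing_of_kdvBundle_eq_zero ha hz hf φ
      rw [h, map_add, map_smul, map_smul, schwartzPairing_solitonOp_solitonDeriv,
        schwartzPairing_solitonOp_solitonSpeedDeriv, zero_mul, smul_zero, zero_add, smul_eq_mul,
        mul_left_comm, mul_eq_zero] at h1
      rw [map_smul, smul_eq_mul]
      exact h1.resolve_left neg_ofReal_sqrt_three_div_two_ne_zero
    have hd0 : d = 0 := (smul_eq_zero.1 hd).resolve_right (solitonDeriv_ne_zero ha')
    refine ⟨c, (weightIso a).injective ?_⟩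
    rw [h, hd0, zero_smul, add_zero, map_smul, weightIso_solitonEigenvector]
  · rintro ⟨c, rfl⟩
    refine (kdvBundle_eq_iff ha hz _ _).2 fun φ => ?_
    rw [map_smul (weightIso a), weightIso_solitonEigenvector, zero_smul, zero_sub,
      map_neg schwartzPairing, zero_sub, map_neg schwartzPairing, map_zero (weightIso a), map_zero,
      neg_apply, map_smul, schwartzPairing_solitonOp_solitonDeriv]
    simp

include ha in
-- Provides a vector outside the range of W₀(0): for a preimage `f`, the vector -f would extend the
-- chain of position and speed derivatives to length three.
theorem kdvBundle_zero_ne (f : WeightedL2 a) :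
    kdvBundle a 0 f ≠ kdvResolvent a 0 (solitonAssociatedVector ha') := by
  have hz : -decayRate a < (0 : ℂ).re := neg_decayRate_neg ha ha'
  intro hf
  have h : ∀ φ, schwartzPairing (solitonOp a φ) (-weightIso a f) =
      schwartzPairing φ ((solitonSpeedDeriv ha').toLp 2 volume) := fun φ => by
    have h1 := (kdvBundle_eq_iff ha hz _ _).1 hf φ
    rw [schwartzPairing_kdvResolvent ha hz, weightIso_solitonAssociatedVector, zero_smul, zero_sub,
      map_neg schwartzPairing, neg_apply] at h1
    rw [map_neg, h1]
  have h0 := eq_zero_of_chain ha ha'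
    (f₀ := (-(((√3 : ℝ) : ℂ) / 2)) • (solitonDeriv ha').toLp 2 volume)
    (fun φ => by rw [map_smul, schwartzPairing_solitonOp_solitonDeriv, smul_zero])
    (fun φ => by rw [map_smul, schwartzPairing_solitonOp_solitonSpeedDeriv, smul_eq_mul]) h
  exact smul_ne_zero neg_ofReal_sqrt_three_div_two_ne_zero (solitonDeriv_ne_zero ha') h0

include ha ha' in
theorem isFredholmBundle_kdvBundle :
    IsFredholmBundle (kdvBundle a) {z : ℂ | -decayRate a < z.re} := by
  have key : ∀ z ∈ {z : ℂ | -decayRate a < z.re}, (kdvBundle a z).IsFredholm ∧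
      Module.finrank ℂ (kdvBundle a z).ker =
        Module.finrank ℂ (WeightedL2 a ⧸ (kdvBundle a z).range) := by
    intro z hz
    have hc := isCompactOperator_kdvBundle_sub_id ha hz
    rcases eq_or_ne z 0 with rfl | hz0
    · exact isFredholm_of_ker_eq_span hc (solitonEigenvector_ne_zero ha')
        (kdvBundle_zero_eq_zero_iff ha ha') (kdvBundle_zero_ne ha ha')
    · have hb := bijective_of_isCompactOperator_id_sub hc
        fun f => eq_zero_of_kdvBundle_eq_zero ha ha' hz hz0
      refine ⟨isFredholm_of_bijective_add (P := 0) LinearMap.HasFiniteRange.zero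
        (by rwa [add_zero]), ?_⟩
      have h1 : (kdvBundle a z).ker = ⊥ := LinearMap.ker_eq_bot.2 hb.1
      have h2 : (kdvBundle a z).range = ⊤ := LinearMap.range_eq_top.2 hb.2
      have : Subsingleton (WeightedL2 a ⧸ (kdvBundle a z).range) :=
        Submodule.Quotient.subsingleton_iff.2 h2
      rw [h1, finrank_bot, Module.finrank_zero_of_subsingleton]
  exact ⟨analyticOnNhd_kdvBundle ha, fun z hz => (key z hz).1, fun z hz => (key z hz).2⟩

include ha ha' in
theorem isCharacteristicValue_kdvBundle_iff {z : ℂ} (hz : -decayRate a < z.re) :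
    IsCharacteristicValue (kdvBundle a) z ↔ z = 0 := by
  constructor
  · rintro ⟨v, hv, hv0⟩
    by_contra hz0
    exact hv (eq_zero_of_kdvBundle_eq_zero ha ha' hz hz0 hv0)
  · rintro rfl
    exact ⟨_, solitonEigenvector_ne_zero ha',
      (kdvBundle_zero_eq_zero_iff ha ha' _).2 ⟨1, (one_smul _ _).symm⟩⟩

/-! ### The rank of the eigenvectors -/

theorem analyticAt_clm_apply {X : Type*} [NormedAddCommGroup X] [NormedSpace ℂ X]
    {W : ℂ → X →L[ℂ] X} {f : ℂ → X} {z : ℂ} (hW : AnalyticAt ℂ W z) (hf : AnalyticAt ℂ f z) :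
    AnalyticAt ℂ (fun w => W w (f w)) z :=
  ((ContinuousLinearMap.id ℂ (X →L[ℂ] X)).analyticAt_bilinear (W z, f z)).comp₂ hW hf

/-- Let z → 0. A punctured neighbourhood is used so that the lemma still applies after division by
powers of z. -/
theorem eq_zero_of_eventually_add_smul {u : ℂ} {r : ℂ → ℂ} (hr : ContinuousAt r 0)
    (h : ∀ᶠ z in 𝓝[≠] (0 : ℂ), u + z * r z = 0) : u = 0 := by
  have h1 : Filter.Tendsto (fun z : ℂ => u + z * r z) (𝓝[≠] 0) (𝓝 (u + 0 * r 0)) :=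
    ((continuousAt_const.add (continuousAt_id.mul hr)).tendsto).mono_left nhdsWithin_le_nhds
  rw [zero_mul, add_zero] at h1
  exact tendsto_nhds_unique h1 ((Filter.tendsto_congr' h).2 tendsto_const_nhds)

theorem eq_zero_of_eventually_cubic {u v w : ℂ} {r : ℂ → ℂ} (hr : ContinuousAt r 0)
    (h : ∀ᶠ z in 𝓝 (0 : ℂ), u + z * v + z ^ 2 * w + z ^ 3 * r z = 0) :
    u = 0 ∧ v = 0 ∧ w = 0 := by
  replace h := h.filter_mono (nhdsWithin_le_nhds (s := {0}ᶜ))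
  have hu : u = 0 := eq_zero_of_eventually_add_smul
    (r := fun z => v + z * w + z ^ 2 * r z) (by fun_prop)
    (h.mono fun z hz => by rw [← hz]; ring)
  have hv : v = 0 := eq_zero_of_eventually_add_smul (r := fun z => w + z * r z) (by fun_prop) (by
    filter_upwards [h, self_mem_nhdsWithin] with z hz hz0
    refine mul_left_cancel₀ hz0 ?_
    rw [mul_zero, ← hz, hu]
    ring)
  refine ⟨hu, hv, eq_zero_of_eventually_add_smul hr ?_⟩
  filter_upwards [h, self_mem_nhdsWithin] with z hz hz0
  refine mul_left_cancel₀ (pow_ne_zero 2 hz0) ?_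
  rw [mul_zero, ← hz, hu, hv]
  ring

theorem eventually_neg_decayRate_lt_re (ha : 0 < a) (ha' : |a| < √3) :
    ∀ᶠ z in 𝓝 (0 : ℂ), -decayRate a < z.re :=
  (isOpen_lt_re _).mem_nhds (neg_decayRate_neg ha ha')

include ha ha' in
-- If W₀(z)f(z) = z³g(z), the coefficients of 1, z, z² in the weak form make the Taylor coefficients
-- of f at 0 a Jordan chain of length three, which forces f(0) = 0.
theorem rootOrder_kdvBundle_le {f : ℂ → WeightedL2 a} (hf : IsRootVector (kdvBundle a) 0 f) :
    rootOrder (kdvBundle a) 0 f ≤ 2 := by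
  by_contra hlt
  have h3 : ((3 : ℕ) : ℕ∞) ≤ rootOrder (kdvBundle a) 0 f := by
    have := Order.add_one_le_of_lt (not_le.1 hlt)
    exact this
  have hW : AnalyticAt ℂ (fun z => kdvBundle a z (f z)) 0 :=
    analyticAt_clm_apply (analyticOnNhd_kdvBundle ha 0 (neg_decayRate_neg ha ha')) hf.analyticAt
  obtain ⟨g, hg, hgf⟩ := (natCast_le_analyticOrderAt hW).1 h3
  obtain ⟨F, hF, hFf⟩ := hf.analyticAt.exists_eventuallyEq_sum_add_pow_mul 3
  set J := weightIso a with hJ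
  set f₀ := J (iteratedDeriv 0 f 0) with hf₀
  set f₁ := J (iteratedDeriv 1 f 0) with hf₁
  set f₂ := J ((2 : ℂ)⁻¹ • iteratedDeriv 2 f 0) with hf₂
  have hfe : ∀ᶠ z in 𝓝 (0 : ℂ), J (f z) = f₀ + z • f₁ + z ^ 2 • f₂ + z ^ 3 • J (F z) := by
    filter_upwards [hFf] with z hz
    rw [hz, hf₀, hf₁, hf₂, Finset.sum_range_succ, Finset.sum_range_succ, Finset.sum_range_one,
      map_add, map_add, map_add, map_smul, map_smul, map_smul, map_smul, map_smul]
    simp [smul_smul, div_eq_mul_inv]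
  have hJF : ∀ {G : ℂ → WeightedL2 a} (_ : AnalyticAt ℂ G 0) (ψ : 𝓢(ℝ, ℂ)),
      ContinuousAt (fun z => schwartzPairing ψ (J (G z))) 0 := fun hG ψ =>
    ((schwartzPairing ψ).continuous.comp J.continuous).continuousAt.comp hG.continuousAt
  have key : ∀ φ : 𝓢(ℝ, ℂ), -schwartzPairing (solitonOp a φ) f₀ = 0 ∧
      schwartzPairing φ f₀ - schwartzPairing (solitonOp a φ) f₁ = 0 ∧
      schwartzPairing φ f₁ - schwartzPairing (solitonOp a φ) f₂ = 0 := fun φ => by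
    refine eq_zero_of_eventually_cubic
      (r := fun z => schwartzPairing φ f₂ - schwartzPairing (solitonOp a φ) (J (F z)) +
        z * schwartzPairing φ (J (F z)) - (z * schwartzPairing φ (J (g z)) -
          schwartzPairing (freeOp a φ) (J (g z)))) ?_ ?_
    · exact ((continuousAt_const.sub (hJF hF _)).add (continuousAt_id.mul (hJF hF _))).sub
        ((continuousAt_id.mul (hJF hg _)).sub (hJF hg _))
    · filter_upwards [hfe, hgf, eventually_neg_decayRate_lt_re ha ha'] with z h1 h2 hz
      have h := (kdvBundle_eq_iff ha hz _ _).1 h2 φ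
      rw [← hJ, h1, sub_zero, map_smul J, map_sub schwartzPairing, map_sub schwartzPairing,
        map_smul schwartzPairing] at h
      simp only [_root_.sub_apply, _root_.smul_apply, map_add, map_smul, smul_eq_mul] at h
      linear_combination -h
  have h0 := eq_zero_of_chain ha ha' (fun φ => neg_eq_zero.1 (key φ).1)
    (fun φ => (sub_eq_zero.1 (key φ).2.1).symm) (fun φ => (sub_eq_zero.1 (key φ).2.2).symm)
  rw [hf₀, iteratedDeriv_zero, map_eq_zero_iff J J.injective] at h0
  exact hf.ne_zero h0

include ha in
-- Take f(z) = e + z e' with `e'` scaled so that Lᵀe' = e. Then (z - Lᵀ)(e + z e') = z² e', so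
-- W₀(z)f(z) is z² times the free resolvent applied to `e'`.
theorem exists_isRootVector_kdvBundle {c : ℂ} (hc : c ≠ 0) :
    ∃ f : ℂ → WeightedL2 a, IsRootVector (kdvBundle a) 0 f ∧
      f 0 = c • solitonEigenvector ha' ∧ 2 ≤ rootOrder (kdvBundle a) 0 f := by
  have hz₀ : -decayRate a < (0 : ℂ).re := neg_decayRate_neg ha ha'
  set κ : ℂ := -(((√3 : ℝ) : ℂ) / 2) with hκ
  have hκ0 : κ ≠ 0 := neg_ofReal_sqrt_three_div_two_ne_zero
  let e := c • solitonEigenvector ha'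
  let e' := (c * κ⁻¹) • solitonAssociatedVector ha'
  let f : ℂ → WeightedL2 a := fun z => e + z • e'
  have hf : AnalyticAt ℂ f 0 := by fun_prop
  have hf0 : f 0 = e := by simp [f]
  have hW : AnalyticAt ℂ (fun z => kdvBundle a z (f z)) 0 :=
    analyticAt_clm_apply (analyticOnNhd_kdvBundle ha 0 hz₀) hf
  refine ⟨f, ⟨hf, ?_, ?_⟩, hf0, ?_⟩
  · rw [hf0]
    exact smul_ne_zero hc (solitonEigenvector_ne_zero ha')
  · rw [hf0]
    exact (kdvBundle_zero_eq_zero_iff ha ha' _).2 ⟨c, rfl⟩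
  · refine (natCast_le_analyticOrderAt hW (n := 2)).2 ⟨fun z => kdvResolvent a z e',
      analyticAt_clm_apply (analyticOnNhd_kdvResolvent ha 0 hz₀) analyticAt_const, ?_⟩
    filter_upwards [eventually_neg_decayRate_lt_re ha ha'] with z hz
    refine (kdvBundle_eq_iff ha hz _ _).2 fun φ => ?_
    rw [sub_zero, map_smul (weightIso a), map_smul (schwartzPairing _),
      schwartzPairing_kdvResolvent ha hz]
    simp only [f, e, e']
    rw [map_add (weightIso a), map_smul (weightIso a) z, map_smul (weightIso a),
      map_smul (weightIso a), weightIso_solitonEigenvector, weightIso_solitonAssociatedVector,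
      map_sub schwartzPairing, map_smul schwartzPairing]
    simp only [_root_.sub_apply, _root_.smul_apply, map_add, map_smul, smul_eq_mul,
      schwartzPairing_solitonOp_solitonDeriv, schwartzPairing_solitonOp_solitonSpeedDeriv, ← hκ]
    field_simp
    ring

include ha ha' in
theorem eigenRank_kdvBundle {v : WeightedL2 a} (hv : v ≠ 0) (hv0 : kdvBundle a 0 v = 0) :
    eigenRank (kdvBundle a) 0 v = 2 := by
  obtain ⟨c, rfl⟩ := (kdvBundle_zero_eq_zero_iff ha ha' v).1 hv0
  have hc : c ≠ 0 := fun h => hv (by rw [h, zero_smul])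
  refine le_antisymm (iSup_le fun f => iSup_le fun hf => iSup_le fun _ =>
    rootOrder_kdvBundle_le ha ha' hf) ?_
  obtain ⟨f, hf, hf0, h2⟩ := exists_isRootVector_kdvBundle ha ha' hc
  exact h2.trans (le_iSup_of_le f (le_iSup_of_le hf (le_iSup_of_le hf0 le_rfl)))

include ha ha' in
-- The kernel is a line on which every nonzero vector has rank two, so a canonical system is a
-- single vector.
theorem hasNullMultiplicity_kdvBundle : HasNullMultiplicity (kdvBundle a) 0 2 := by
  have hker : (kdvBundle a 0).ker = Submodule.span ℂ {solitonEigenvector ha'} := by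
    ext x
    rw [Submodule.mem_span_singleton]
    exact (kdvBundle_zero_eq_zero_iff ha ha' x).trans
      ⟨fun ⟨c, h⟩ => ⟨c, h.symm⟩, fun ⟨c, h⟩ => ⟨c, h.symm⟩⟩
  have he := solitonEigenvector_ne_zero ha'
  have he0 : kdvBundle a 0 (solitonEigenvector ha') = 0 :=
    (kdvBundle_zero_eq_zero_iff ha ha' _).2 ⟨1, (one_smul _ _).symm⟩
  refine ⟨analyticOnNhd_kdvBundle ha 0 (neg_decayRate_neg ha ha'),
    ⟨1, fun _ => solitonEigenvector ha', ?_, ?_, ?_⟩, ?_⟩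
  · exact linearIndependent_unique_iff.2 he
  · rw [hker, Set.range_const]
  · intro j
    have hj : {i : Fin 1 | i < j} = ∅ := by
      ext i
      simp [Subsingleton.elim i j]
    -- No index precedes `j`, so the complement is the whole kernel.
    refine ⟨(kdvBundle a 0).ker, ?_, ?_, he0, fun u hu hu0 => ?_⟩
    · simp [hj]
    · simp [hj]
    · rw [eigenRank_kdvBundle ha ha' hu0 hu, eigenRank_kdvBundle ha ha' he he0]
  · intro r v hv
    have hr : r = 1 := by
      have h := finrank_span_eq_card hv.linearIndependent
      rw [hv.span_eq, hker, finrank_span_singleton he, Fintype.card_fin] at h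
      exact h.symm
    have hv2 : ∀ j, eigenRank (kdvBundle a) 0 (v j) = 2 := fun j => by
      refine eigenRank_kdvBundle ha ha' (hv.linearIndependent.ne_zero j) ?_
      have : v j ∈ (kdvBundle a 0).ker := hv.span_eq ▸ Submodule.subset_span ⟨j, rfl⟩
      exact this
    subst hr
    simp [hv2]

end Chain

end

theorem proposition11p3 (α β : ℝ) (hα₀ : 0 < α) (hα : α < √3)
    (hβ : β = 1 / 2 * α * (1 - α ^ 2 / 3)) :
    IsFredholmBundle (kdvBundle α) {z : ℂ | -β < z.re} ∧
    (∀ z : ℂ, -β < z.re → (IsCharacteristicValue (kdvBundle α) z ↔ z = 0)) ∧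
    HasNullMultiplicity (kdvBundle α) 0 2 := by
  have hα' : |α| < √3 := by rwa [abs_of_pos hα₀]
  obtain rfl : β = decayRate α := hβ
  exact ⟨isFredholmBundle_kdvBundle hα₀ hα',
    fun z hz => isCharacteristicValue_kdvBundle_iff hα₀ hα' hz,
    hasNullMultiplicity_kdvBundle hα₀ hα'⟩
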